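/- **Theorem (operator-valued version of Cwikel's theorem).** Let $(X,dx)$ and $(Y,dy)$ be sigma-finite measure spaces and let $\mathcal H$ and $\mathcal G$ be separable complex Hilbert spaces. For a compact operator $K$ between Hilbert spaces let $|K|=(K^*K)^{1/2}$, let $n(\kappa,|K|)$ be the number of eigenvalues of $|K|$ larger than $\kappa$, counted with multiplicities, and for $q>0$ put $$\|K\|_{\mathfrak S_q}^q=\operatorname{tr}|K|^q,\qquad \|K\|_{q,w}^q=\sup_{\kappa>0}\kappa^q\,n(\kappa,|K|).$$ The class $\mathfrak S_{q,w}$ consists of the compact operators $K$ with $\|K\|_{q,w}<\infty$. Let $L_q(X,\mathfrak S_q(\mathcal H))$ be the space of measurable functions $f$ on $X$ with values in the compact operators on $\mathcal H$ such that $$\|f\|_{L_q(\mathfrak S_q)}^q=\int_X\|f(x)\|_{\mathfrak S_q}^q\,dx<\infty,$$ and let $L_{q,w}(Y,\mathfrak B(\mathcal G))$ be the space of measurable functions $g$ on $Y$ with values in the bounded operators on $\mathcal G$ such that $$\|g\|_{L_{q,w}(\mathfrak B)}^q=\sup_{\tau>0}\tau^q\,\bigl|\{y\in Y:\ \|g(y)\|>\tau\}\bigr|<\infty$$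 (measurability of an operator-valued function $h$ means measurability of $h(\cdot)v$ for every vector $v$). Let $\Phi:L_2(X,\mathcal H)\to L_2(Y,\mathcal G)$ be a unitary operator which maps $L_1(X,\mathcal H)$ boundedly into $L_\infty(Y,\mathcal G)$, that is, the smallest constant $C=\|\Phi\|_{L_1\to L_\infty}$ with $\|\Phi u\|_{L_\infty}\le C\|u\|_{L_1}$ for all $u\in L_1(X,\mathcal H)\cap L_2(X,\mathcal H)$ is finite. Let $q>2$, $f\in L_q(X,\mathfrak S_q(\mathcal H))$ and $g\in L_{q,w}(Y,\mathfrak B(\mathcal G))$. Then the operator $f\,\Phi^*g$, defined on its natural domain $$\{u\in L_2(Y,\mathcal G):\ gu\in L_2(Y,\mathcal G),\ f\,\Phi^*(gu)\in L_2(X,\mathcal H)\},$$ is densely defined and extends (uniquely) to a bounded operator from $L_2(Y,\mathcal G)$ to $L_2(X,\mathcal H)$. This extension, again denoted $f\,\Phi^*g$, belongs to $\mathfrak S_{q,w}(L_2(Y,\mathcal G),L_2(X,\mathcal H))$ and satisfies $$\|f\,\Phi^*g\|_{q,w}^q\le\frac q2\left(\frac q{q-2}\right)^{q-1}C^2\,\|f\|_{L_q(\mathfrak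 S_q)}^q\,\|g\|_{L_{q,w}(\mathfrak B)}^q .$$ -/

import Mathlib

open MeasureTheory
open scoped ENNReal

noncomputable section

namespace Cwikel

section SingularValues

variable {E F : Type*} [NormedAddCommGroup E] [InnerProductSpace ℂ E] [CompleteSpace E]
  [NormedAddCommGroup F] [InnerProductSpace ℂ F] [CompleteSpace F]

/-- The absolute value `|K| = (K* K)^{1/2}` of a bounded operator `K : E → F` between
Hilbert spaces. -/
def absOp (K : E →L[ℂ] F) : E →L[ℂ] E :=
  CFC.sqrt (ContinuousLinearMap.adjoint K ∘L K)

/-- The multiplicity (possibly `0` or `∞`) of the real number `s` as an eigenvalue of an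
operator `A`. -/
def eigenMult (A : E →L[ℂ] E) (s : ℝ) : ℝ≥0∞ :=
  ((Module.rank ℂ (Module.End.eigenspace (A : E →ₗ[ℂ] E) (s : ℂ))).toENat : ℝ≥0∞)

/-- `n(κ, A)`: the number of eigenvalues of `A` larger than `κ`, counting multiplicities. -/
def eigenCount (κ : ℝ) (A : E →L[ℂ] E) : ℝ≥0∞ :=
  ∑' s : Set.Ioi κ, eigenMult A s

/-- The Schatten norm `(tr |K|^q)^{1/q}`, that is, the `ℓ^q` norm of the nonzero eigenvalues of
`|K|`, counted with multiplicity (meaningful for compact `K`). -/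
def schattenNorm (q : ℝ) (K : E →L[ℂ] F) : ℝ≥0∞ :=
  (∑' s : Set.Ioi (0 : ℝ), ENNReal.ofReal ((s : ℝ) ^ q) * eigenMult (absOp K) s) ^ (1 / q)

/-- The weak Schatten quasi-norm: `‖K‖_{q,w}^q = sup_{κ > 0} κ^q n(κ, |K|)`. -/
def weakSchattenNorm (q : ℝ) (K : E →L[ℂ] F) : ℝ≥0∞ :=
  (⨆ κ : Set.Ioi (0 : ℝ), ENNReal.ofReal ((κ : ℝ) ^ q) * eigenCount κ (absOp K)) ^ (1 / q)

/-- Membership in the weak Schatten class `𝔖_{q,w}(E, F)`. -/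
def MemWeakSchatten (q : ℝ) (K : E →L[ℂ] F) : Prop :=
  IsCompactOperator K ∧ weakSchattenNorm q K < ∞

end SingularValues

section Functions

variable {X H : Type*} [MeasurableSpace X] [NormedAddCommGroup H] [InnerProductSpace ℂ H]

/-- Measurability of an operator-valued function on a separable Hilbert space: all its orbit
maps `x ↦ f x v` are (almost everywhere) measurable. -/
def OpMeasurable (f : X → H →L[ℂ] H) (μ : Measure X) : Prop :=
  ∀ v : H, AEStronglyMeasurable (fun x => f x v) μ

/-- The norm of `L_q(X, 𝔖_q(H))`. -/
def schattenLpNorm [CompleteSpace H] (q : ℝ) (f : X → H →L[ℂ] H) (μ : Measure X) : ℝ≥0∞ :=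
  (∫⁻ x, schattenNorm q (f x) ^ q ∂μ) ^ (1 / q)

/-- Membership in `L_q(X, 𝔖_q(H))`. -/
def MemSchattenLp [CompleteSpace H] (q : ℝ) (f : X → H →L[ℂ] H) (μ : Measure X) : Prop :=
  OpMeasurable f μ ∧ (∀ᵐ x ∂μ, IsCompactOperator (f x)) ∧ schattenLpNorm q f μ < ∞

/-- The quasi-norm of `L_{q,w}(X, 𝔅(H))`:
`‖g‖^q = sup_{τ > 0} τ^q μ {x | ‖g x‖ > τ}`. -/
def weakLpNorm (q : ℝ) (g : X → H →L[ℂ] H) (μ : Measure X) : ℝ≥0∞ :=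
  (⨆ τ : Set.Ioi (0 : ℝ), ENNReal.ofReal ((τ : ℝ) ^ q) * μ {x | (τ : ℝ) < ‖g x‖}) ^ (1 / q)

/-- Membership in `L_{q,w}(X, 𝔅(H))`. -/
def MemWeakLp (q : ℝ) (g : X → H →L[ℂ] H) (μ : Measure X) : Prop :=
  OpMeasurable g μ ∧ weakLpNorm q g μ < ∞

/-- The (in general unbounded) operator of multiplication by an operator-valued function `f` in
`L_2(X, H)`, on its maximal domain `{u ∈ L_2 | f u ∈ L_2}`. -/
def mulOp (f : X → H →L[ℂ] H) (μ : Measure X) : Lp H 2 μ →ₗ.[ℂ] Lp H 2 μ where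
  domain :=
    { carrier := {u | MemLp (fun x => f x (u x)) 2 μ}
      zero_mem' := by
        refine MemLp.ae_eq (f := fun _ => (0 : H)) ?_ MemLp.zero'
        filter_upwards [Lp.coeFn_zero H 2 μ] with x hx
        rw [hx, Pi.zero_apply, map_zero]
      add_mem' := by
        intro u v hu hv
        refine MemLp.ae_eq ?_ (MemLp.add hu hv)
        filter_upwards [Lp.coeFn_add u v] with x hx
        rw [hx, Pi.add_apply, Pi.add_apply, map_add]
      smul_mem' := by
        intro c u hu
        refine MemLp.ae_eq ?_ (MemLp.const_smul hu c)
        filter_upwards [Lp.coeFn_smul c u] with x hx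
        rw [hx, Pi.smul_apply, Pi.smul_apply, map_smul] }
  toFun :=
    { toFun := fun u => MemLp.toLp (fun x => f x ((u : Lp H 2 μ) x)) u.2
      map_add' := by
        intro u v
        rw [← MemLp.toLp_add]
        refine MemLp.toLp_congr _ _ ?_
        filter_upwards [Lp.coeFn_add (u : Lp H 2 μ) (v : Lp H 2 μ)] with x hx
        change f x (((u : Lp H 2 μ) + (v : Lp H 2 μ) : Lp H 2 μ) x) = _
        rw [hx, Pi.add_apply, Pi.add_apply, map_add]
      map_smul' := by
        intro c u
        rw [RingHom.id_apply, ← MemLp.toLp_const_smul]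
        refine MemLp.toLp_congr _ _ ?_
        filter_upwards [Lp.coeFn_smul c (u : Lp H 2 μ)] with x hx
        change f x ((c • (u : Lp H 2 μ) : Lp H 2 μ) x) = _
        rw [hx, Pi.smul_apply, Pi.smul_apply, map_smul] }

end Functions

/-- The composition `A B` of two unbounded operators, on its natural domain
`{u ∈ dom B | B u ∈ dom A}`. -/
def pcomp {E F G : Type*} [AddCommGroup E] [Module ℂ E] [AddCommGroup F] [Module ℂ F]
    [AddCommGroup G] [Module ℂ G] (A : F →ₗ.[ℂ] G) (B : E →ₗ.[ℂ] F) : E →ₗ.[ℂ] G where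
  domain :=
    { carrier := {u | ∃ h : u ∈ B.domain, B ⟨u, h⟩ ∈ A.domain}
      zero_mem' := ⟨B.domain.zero_mem, by
        have h : B ⟨0, B.domain.zero_mem⟩ = 0 := B.map_zero
        rw [h]; exact A.domain.zero_mem⟩
      add_mem' := by
        rintro u v ⟨hu, hu'⟩ ⟨hv, hv'⟩
        refine ⟨B.domain.add_mem hu hv, ?_⟩
        have h : B ⟨u + v, B.domain.add_mem hu hv⟩ = B ⟨u, hu⟩ + B ⟨v, hv⟩ :=
          B.map_add ⟨u, hu⟩ ⟨v, hv⟩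
        rw [h]; exact A.domain.add_mem hu' hv'
      smul_mem' := by
        rintro c u ⟨hu, hu'⟩
        refine ⟨B.domain.smul_mem c hu, ?_⟩
        have h : B ⟨c • u, B.domain.smul_mem c hu⟩ = c • B ⟨u, hu⟩ :=
          B.map_smul c ⟨u, hu⟩
        rw [h]; exact A.domain.smul_mem c hu' }
  toFun :=
    { toFun := fun u => A ⟨B ⟨u, u.2.fst⟩, u.2.snd⟩
      map_add' := by
        intro u v
        rw [← A.map_add]
        congr 1
        exact Subtype.ext (B.map_add ⟨u, u.2.fst⟩ ⟨v, v.2.fst⟩)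
      map_smul' := by
        intro c u
        rw [RingHom.id_apply, ← A.map_smul]
        congr 1
        exact Subtype.ext (B.map_smul c ⟨u, u.2.fst⟩) }

section Phi

variable {X Y H G : Type*} [MeasurableSpace X] [MeasurableSpace Y]
  [NormedAddCommGroup H] [InnerProductSpace ℂ H] [NormedAddCommGroup G] [InnerProductSpace ℂ G]
  {μ : Measure X} {ν : Measure Y}

/-- The norm `‖Φ‖_{L_1 → L_∞}` of an operator `Φ : L_2(X, H) → L_2(Y, G)`: the best constant in
`‖Φ u‖_∞ ≤ C ‖u‖_1` for `u ∈ L_1 ∩ L_2`; it is finite exactly when `Φ` maps `L_1` boundedly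
into `L_∞`. -/
def oneInftyNorm (Φ : Lp H 2 μ ≃ₗᵢ[ℂ] Lp G 2 ν) : ℝ≥0∞ :=
  sInf {C : ℝ≥0∞ | ∀ u : Lp H 2 μ, MemLp u 1 μ → eLpNorm (Φ u) ∞ ν ≤ C * eLpNorm u 1 μ}

/-- The operator `f Φ* g` from `L_2(Y, G)` to `L_2(X, H)` on its natural domain
`{u ∈ L_2(Y, G) | g u ∈ L_2(Y, G), f Φ* (g u) ∈ L_2(X, H)}`. -/
def cwikelOp [CompleteSpace H] [CompleteSpace G] (f : X → H →L[ℂ] H)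
    (Φ : Lp H 2 μ ≃ₗᵢ[ℂ] Lp G 2 ν) (g : Y → G →L[ℂ] G) : Lp G 2 ν →ₗ.[ℂ] Lp H 2 μ :=
  pcomp (mulOp f μ)
    (LinearMap.compPMap
      (ContinuousLinearMap.adjoint
        (Φ.toContinuousLinearEquiv : Lp H 2 μ →L[ℂ] Lp G 2 ν)).toLinearMap
      (mulOp g ν))

end Phi

end Cwikel

end

noncomputable section

namespace Cwikel

/-! ### Singular values, eigenvalue counting and compactness via orthonormal families. -/

section AbsOp

variable {E F : Type*} [NormedAddCommGroup E] [InnerProductSpace ℂ E] [CompleteSpace E]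
  [NormedAddCommGroup F] [InnerProductSpace ℂ F] [CompleteSpace F]

/-! Let `K` extend f Φ* g, and let u_1, …, u_N be orthonormal with ‖K u_j‖ ≥ κ. Bounding N bounds
the eigenvalue count of |K| (`eigenCount_absOp_le`) and also gives compactness
(`isCompactOperator_of_orthonormal_bound`). It suffices to show ∑ ‖K u_j‖² ≤ ‖f‖² (D N)^(1-2/q):
comparing with N κ² and cancelling a power of N gives κ^q N ≤ ‖f‖^q D^(q/2-1).

The estimate is a density bound in the manner of Rumin. Put φ_j = Φ*(g u_j) and, for each level e >
0, split g where ‖g‖² = 1/e. Since Φ* also maps L¹ to L^∞ (`ae_enorm_symm_le`), the part with large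
g has, at almost every x, a synthesis operator of norm at most C (∫ ‖g‖²)^(1/2), the integral being
over {e‖g‖² > 1}; the weak bound on g makes this α e^a with a = (q-2)/4 and α² = C² ‖g‖^q q/(q-2)
(`ae_norm_sum_symm_le`, `setLIntegral_enorm_sq_le_weakLpNorm`). The part with small g satisfies ∫
‖low_e‖² de ≤ ‖u_j‖², because ∫ 1_{e n² ≤ 1} n² de ≤ 1 (`tsum_weight_enorm_sq_le`).

Fix x and a right singular vector h of f(x), and let r be the length of (⟨h, φ_j(x)⟩)_j. The low
part has length at least r - α e^a, and ∫ (r - α e^a)₊² de is a constant times r^(2+1/a) =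
(r²)^(q/(q-2)). Summing over h by Bessel and applying Hölder with exponents q/2 and q/(q-2), first
to the singular values of f(x) (`sum_enorm_apply_sq_le`) and then in x (`lintegral_sum_le`), gives
the claim.

The integral over e is replaced by sums over a grid θ^m, so only countably many exceptional null
sets occur. This costs a factor θ, which fits into the gap between the sharp output of the method
and the stated constant (`ruminConst_rpow_le`). -/

lemma absOp_nonneg (K : E →L[ℂ] F) : 0 ≤ absOp K := CFC.sqrt_nonneg _

lemma absOp_mul_self (K : E →L[ℂ] F) :
    absOp K * absOp K = ContinuousLinearMap.adjoint K ∘L K := by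
  refine CFC.sqrt_mul_sqrt_self _ ?_
  rw [ContinuousLinearMap.nonneg_iff_isPositive]
  exact ContinuousLinearMap.isPositive_adjoint_comp_self K

lemma absOp_isPositive (K : E →L[ℂ] F) : (absOp K).IsPositive :=
  (ContinuousLinearMap.nonneg_iff_isPositive _).1 (absOp_nonneg K)

lemma absOp_isSymmetric (K : E →L[ℂ] F) : ((absOp K : E →L[ℂ] E) : E →ₗ[ℂ] E).IsSymmetric :=
  (absOp_isPositive K).isSymmetric

lemma norm_absOp_apply (K : E →L[ℂ] F) (v : E) : ‖absOp K v‖ = ‖K v‖ := by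
  have h : inner ℂ (absOp K v) (absOp K v) = inner ℂ (K v) (K v) := by
    have h1 : inner ℂ (absOp K v) (absOp K v) = inner ℂ ((absOp K * absOp K) v) v :=
      (absOp_isSymmetric K (absOp K v) v).symm
    rw [h1, absOp_mul_self, ContinuousLinearMap.comp_apply,
      ContinuousLinearMap.adjoint_inner_left]
  rw [inner_self_eq_norm_sq_to_K, inner_self_eq_norm_sq_to_K] at h
  have h2 : ‖absOp K v‖ ^ 2 = ‖K v‖ ^ 2 := by exact_mod_cast h
  exact (sq_eq_sq₀ (norm_nonneg _) (norm_nonneg _)).1 h2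

-- Applied to differences, the equality of norms carries a finite ε-net of the image of the ball
-- under `K` to one under `A`, so no polar decomposition is needed.
omit [CompleteSpace E] [CompleteSpace F] in
lemma isCompactOperator_of_norm_eq {G : Type*} [NormedAddCommGroup G] [NormedSpace ℂ G]
    [CompleteSpace G] {K : E →L[ℂ] F} {A : E →L[ℂ] G} (h : ∀ v, ‖A v‖ = ‖K v‖)
    (hK : IsCompactOperator K) : IsCompactOperator A := by
  refine (isCompactOperator_iff_isCompact_closure_image_closedBall A.toLinearMap one_pos).2 ?_
  have hK' := (isCompactOperator_iff_isCompact_closure_image_closedBall K.toLinearMap one_pos).1 hK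
  refine TotallyBounded.isCompact_of_isClosed ?_ isClosed_closure
  refine TotallyBounded.closure ?_
  have h1 := hK'.totallyBounded.subset subset_closure
  refine Metric.totallyBounded_iff.2 fun ε hε => ?_
  obtain ⟨t, ht, htf, hcov⟩ := Metric.finite_approx_of_totallyBounded h1 ε hε
  obtain ⟨t', ht', htf', rfl⟩ := Set.exists_subset_image_finite_and.1 ⟨t, ht, htf, rfl⟩
  refine ⟨A '' t', htf'.image _, ?_⟩
  rintro _ ⟨v, hv, rfl⟩
  have h2 := hcov (Set.mem_image_of_mem _ hv)
  simp only [Set.mem_iUnion, Set.mem_image, exists_prop, exists_exists_and_eq_and] at h2 ⊢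
  obtain ⟨w, hw, hvw⟩ := h2
  refine ⟨w, hw, ?_⟩
  rw [Metric.mem_ball, dist_eq_norm] at hvw ⊢
  have : ‖A (v - w)‖ < ε := by rw [h, map_sub]; exact hvw
  rwa [map_sub] at this

lemma isCompactOperator_absOp {K : E →L[ℂ] F} (hK : IsCompactOperator K) :
    IsCompactOperator (absOp K) :=
  isCompactOperator_of_norm_eq (norm_absOp_apply K) hK

/-- Eigenvectors of `|K|` for positive eigenvalues, forming an orthonormal family. -/
lemma exists_singular_family {K : E →L[ℂ] F} (hK : IsCompactOperator K) :
    ∃ (n : Set.Ioi (0 : ℝ) → ℕ) (h : (Σ s : Set.Ioi (0 : ℝ), Fin (n s)) → E),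
      (∀ s : Set.Ioi (0 : ℝ), eigenMult (absOp K) s = n s) ∧ Orthonormal ℂ h ∧
      ∀ v, ‖K v‖ₑ ^ 2 = ∑' i, ENNReal.ofReal i.1 ^ 2 * ‖inner ℂ (h i) v‖ₑ ^ 2 := by
  classical
  set A := absOp K with hA
  have hAc : IsCompactOperator A := isCompactOperator_absOp hK
  have hAs : (A : E →ₗ[ℂ] E).IsSymmetric := absOp_isSymmetric K
  have hfin : ∀ s : Set.Ioi (0 : ℝ),
      FiniteDimensional ℂ (Module.End.eigenspace (A : E →ₗ[ℂ] E) ((s : ℝ) : ℂ)) := fun s =>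
    A.finite_dimensional_eigenspace hAc _ (by exact_mod_cast s.2.ne')
  let V : Set.Ioi (0 : ℝ) → Submodule ℂ E :=
    fun s => Module.End.eigenspace (A : E →ₗ[ℂ] E) ((s : ℝ) : ℂ)
  have hV : OrthogonalFamily ℂ (fun s => V s) fun s => (V s).subtypeₗᵢ :=
    hAs.orthogonalFamily_eigenspaces.comp (γ := Set.Ioi (0 : ℝ)) (f := fun s => ((s : ℝ) : ℂ))
      (fun a b hab => Subtype.ext (Complex.ofReal_injective hab))
  let b : ∀ s, OrthonormalBasis (Fin (Module.finrank ℂ (V s))) ℂ (V s) := fun s =>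
    stdOrthonormalBasis ℂ (V s)
  let h : (Σ s : Set.Ioi (0 : ℝ), Fin (Module.finrank ℂ (V s))) → E := fun i => (b i.1 i.2 : E)
  have hh : Orthonormal ℂ h := hV.orthonormal_sigma_orthonormal fun s => (b s).orthonormal
  have hAh : ∀ i, A (h i) = ((i.1 : ℝ) : ℂ) • h i := fun i =>
    Module.End.mem_eigenspace_iff.1 (b i.1 i.2).2
  -- `A w` is orthogonal to every eigenvector: negative eigenvalues contradict positivity, the
  -- eigenvalue 0 annihilates the inner product, and positive ones are covered by `h`. Eigenvectors
  -- of a compact symmetric operator are total, so `A w = 0`.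
  have hker : ∀ w, (∀ i, inner ℂ (h i) w = 0) → A w = 0 := by
    intro w hw
    have hpos : ∀ s, ∀ z ∈ V s, inner ℂ z w = 0 := by
      intro s z hz
      have hz' : z = ∑ j, (b s).repr ⟨z, hz⟩ j • (b s j : E) := by
        have := congrArg Subtype.val ((b s).sum_repr ⟨z, hz⟩)
        simpa using this.symm
      rw [hz', sum_inner]
      refine Finset.sum_eq_zero fun j _ => ?_
      rw [inner_smul_left, hw ⟨s, j⟩, mul_zero]
    have hmem : A w ∈ (⨆ c, Module.End.eigenspace (A : Module.End ℂ E) c)ᗮ := by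
      rw [← Submodule.iInf_orthogonal, Submodule.mem_iInf]
      intro c
      rw [Submodule.mem_orthogonal]
      intro z hz
      have hz' : A z = c • z := Module.End.mem_eigenspace_iff.1 hz
      have e1 : inner ℂ z (A w) = inner ℂ (A z) w := (hAs z w).symm
      by_cases hz0 : z = 0
      · simp [hz0]
      rw [e1, hz']
      have hcr : c = (starRingEnd ℂ) c := by
        have := hAs.conj_eigenvalue_eq_self
          (Module.End.hasEigenvalue_of_hasEigenvector ⟨hz, hz0⟩)
        exact this.symm
      obtain ⟨r, rfl⟩ : ∃ r : ℝ, (r : ℂ) = c := Complex.conj_eq_iff_real.1 hcr.symm |>.imp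
        fun r hr => hr.symm
      rcases lt_trichotomy r 0 with hr | hr | hr
      · exfalso
        have := (absOp_isPositive K).re_inner_nonneg_left z
        rw [← hA, hz', inner_smul_left, inner_self_eq_norm_sq_to_K] at this
        have h3 : (0 : ℝ) ≤ r * ‖z‖ ^ 2 := by
          have e : (starRingEnd ℂ) (r : ℂ) * ((‖z‖ : ℝ) : ℂ) ^ 2 = ((r * ‖z‖ ^ 2 : ℝ) : ℂ) := by
            rw [Complex.conj_ofReal]; push_cast; rfl
          erw [e] at this
          rwa [RCLike.re_eq_complex_re, Complex.ofReal_re] at this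
        have : 0 < ‖z‖ ^ 2 := by positivity
        nlinarith
      · simp [hr]
      · rw [inner_smul_left, hpos ⟨r, hr⟩ z hz, mul_zero]
    rw [A.orthogonalComplement_iSup_eigenspaces_eq_bot hAc hAs] at hmem
    exact (Submodule.mem_bot ℂ).1 hmem
  refine ⟨fun s => Module.finrank ℂ (V s), h, fun s => ?_, hh, fun v => ?_⟩
  · have := hfin s
    simp only [eigenMult, V]
    rw [← Module.finrank_eq_rank, Cardinal.toENat_nat]
    rfl
  -- Parseval for `A v` in a Hilbert basis extending `h`; by `hker` the added basis vectors
  -- contribute nothing.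
  obtain ⟨w, B, hw, hB⟩ := hh.toSubtypeRange.exists_hilbertBasis_extension
  have hBsum := B.hasSum_inner_mul_inner (A v) (A v)
  have hterm : ∀ i : w, inner ℂ (A v) (B i) * inner ℂ (B i) (A v)
      = ((‖inner ℂ (A (B i)) v‖ ^ 2 : ℝ) : ℂ) := by
    intro i
    have e : inner ℂ (B i) (A v) = inner ℂ (A (B i)) v := (hAs _ _).symm
    rw [← inner_conj_symm, e, RCLike.conj_mul]
    push_cast; rfl
  simp_rw [hterm] at hBsum
  rw [inner_self_eq_norm_sq_to_K] at hBsum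
  have hBsum' : HasSum (fun i : w => ‖inner ℂ (A (B i)) v‖ ^ 2) (‖A v‖ ^ 2) := by
    refine Complex.hasSum_ofReal.1 ?_
    simpa using hBsum
  have e1 : ‖K v‖ₑ ^ 2 = ∑' i : w, ‖inner ℂ (A (B i)) v‖ₑ ^ 2 := by
    rw [← ofReal_norm, ← norm_absOp_apply, ← ENNReal.ofReal_pow (norm_nonneg _), ← hA,
      ← hBsum'.tsum_eq, ENNReal.ofReal_tsum_of_nonneg (fun _ => by positivity) hBsum'.summable]
    refine tsum_congr fun i => ?_
    rw [ENNReal.ofReal_pow (norm_nonneg _), ofReal_norm]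
  rw [e1]
  let φ : (Σ s : Set.Ioi (0 : ℝ), Fin (Module.finrank ℂ (V s))) → w :=
    fun i => ⟨h i, hw ⟨i, rfl⟩⟩
  have hφ : Function.Injective φ := fun i j hij =>
    hh.linearIndependent.injective (congrArg Subtype.val hij)
  rw [← hφ.tsum_eq]
  · refine tsum_congr fun i => ?_
    have : B (φ i) = h i := by rw [hB]
    rw [this, hAh, inner_smul_left, Complex.conj_ofReal, enorm_mul, mul_pow]
    congr 2
    rw [← ofReal_norm, Complex.norm_real, Real.norm_of_nonneg (le_of_lt i.1.2)]
  · intro x hx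
    by_contra hx'
    refine hx ?_
    have : A (B x) = 0 := by
      refine hker _ fun i => ?_
      have hne : φ i ≠ x := fun e => hx' ⟨i, e⟩
      have e2 : B (φ i) = h i := by rw [hB]
      rw [← e2]
      exact B.orthonormal.2 hne
    simp [this]

lemma schattenNorm_rpow {q : ℝ} (hq : 0 < q) (K : E →L[ℂ] F) {n : Set.Ioi (0 : ℝ) → ℕ}
    (hn : ∀ s : Set.Ioi (0 : ℝ), eigenMult (absOp K) s = n s) :
    schattenNorm q K ^ q =
      ∑' i : (Σ s : Set.Ioi (0 : ℝ), Fin (n s)), ENNReal.ofReal i.1 ^ q := by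
  rw [schattenNorm, ← ENNReal.rpow_mul, one_div_mul_cancel hq.ne', ENNReal.rpow_one,
    ENNReal.tsum_sigma']
  refine tsum_congr fun s => ?_
  rw [hn, tsum_fintype]
  simp only [Finset.sum_const, Finset.card_univ, Fintype.card_fin, nsmul_eq_mul]
  rw [mul_comm, ENNReal.ofReal_rpow_of_pos s.2]

/-- The number of eigenvalues of `|K|` above `κ` is bounded by the size of orthonormal families
on which `K` is bounded below by `κ`. -/
lemma eigenCount_absOp_le (K : E →L[ℂ] F) {κ : ℝ} {M : ℝ≥0∞}
    (hM : ∀ (N : ℕ) (u : Fin N → E), Orthonormal ℂ u → (∀ j, κ ≤ ‖K (u j)‖) → (N : ℝ≥0∞) ≤ M) :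
    eigenCount κ (absOp K) ≤ M := by
  classical
  set A := absOp K with hA
  have hAs : (A : E →ₗ[ℂ] E).IsSymmetric := absOp_isSymmetric K
  let V : Set.Ioi κ → Submodule ℂ E :=
    fun s => Module.End.eigenspace (A : E →ₗ[ℂ] E) ((s : ℝ) : ℂ)
  have hV : OrthogonalFamily ℂ (fun s => V s) fun s => (V s).subtypeₗᵢ :=
    hAs.orthogonalFamily_eigenspaces.comp (γ := Set.Ioi κ) (f := fun s => ((s : ℝ) : ℂ))
      (fun a b hab => Subtype.ext (Complex.ofReal_injective hab))
  have key : ∀ (t : Finset (Set.Ioi κ)) (n : Set.Ioi κ → ℕ),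
      (∀ s, ∃ b : Fin (n s) → V s, Orthonormal ℂ b) → ((∑ s ∈ t, n s : ℕ) : ℝ≥0∞) ≤ M := by
    intro t n hb
    choose b hb using hb
    let h : (Σ s : Set.Ioi κ, Fin (n s)) → E := fun i => (b i.1 i.2 : E)
    have hh : Orthonormal ℂ h := hV.orthonormal_sigma_orthonormal hb
    let g : (Σ s : t, Fin (n s)) → (Σ s : Set.Ioi κ, Fin (n s)) := fun i => ⟨i.1, i.2⟩
    have hg : Function.Injective g := by
      rintro ⟨⟨a, ha⟩, i⟩ ⟨⟨c, hc⟩, j⟩ hij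
      simp only [g, Sigma.mk.injEq] at hij
      obtain ⟨rfl, h2⟩ := hij
      simp only [heq_eq_eq] at h2
      rw [h2]
    have hcard : Fintype.card (Σ s : t, Fin (n s)) = ∑ s ∈ t, n s := by
      rw [Fintype.card_sigma, ← Finset.sum_coe_sort t]; simp
    let e := (Fintype.equivFinOfCardEq hcard).symm
    refine hM _ (h ∘ g ∘ e) (hh.comp _ (hg.comp e.injective)) fun j => ?_
    have h1 : A (h (g (e j))) = (((g (e j)).1 : ℝ) : ℂ) • h (g (e j)) :=
      Module.End.mem_eigenspace_iff.1 (b _ _).2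
    rw [← norm_absOp_apply, ← hA, Function.comp_apply, Function.comp_apply, h1, norm_smul,
      hh.1, mul_one, Complex.norm_real]
    exact (le_of_lt (g (e j)).1.2).trans (le_abs_self _)
  rw [eigenCount, ENNReal.tsum_eq_iSup_sum]
  refine iSup_le fun t => ?_
  by_cases hfin : ∀ s : Set.Ioi κ, FiniteDimensional ℂ (V s)
  · have h1 := key t (fun s => Module.finrank ℂ (V s))
      fun s => ⟨_, (stdOrthonormalBasis ℂ (V s)).orthonormal⟩
    refine le_trans (le_of_eq ?_) h1
    push_cast
    refine Finset.sum_congr rfl fun s _ => ?_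
    have := hfin s
    simp only [eigenMult, V] at this ⊢
    rw [← Module.finrank_eq_rank, Cardinal.toENat_nat]
    rfl
  -- An infinite-dimensional eigenspace contains, by Gram–Schmidt, orthonormal families of every
  -- size, so the bound `M` must be infinite.
  · push Not at hfin
    obtain ⟨s, hs⟩ := hfin
    have htop : M = ∞ := by
      refine ENNReal.eq_top_of_forall_nnreal_le fun r => ?_
      obtain ⟨N, hN⟩ := exists_nat_ge r
      have hr : (N : Cardinal) ≤ Module.rank ℂ (V s) := by
        refine Cardinal.natCast_lt_aleph0.le.trans ?_
        by_contra hlt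
        exact hs (Module.rank_lt_aleph0_iff.1 (not_le.1 hlt))
      obtain ⟨v, hv⟩ := Module.le_rank_iff.1 hr
      have := key {s} (fun s' => if s' = s then N else 0) (fun s' => by
        by_cases hs' : s' = s
        · subst hs'
          rw [if_pos rfl]
          exact ⟨_, InnerProductSpace.gramSchmidtNormed_orthonormal hv⟩
        · rw [if_neg hs']
          exact ⟨fun j => j.elim0, by constructor <;> intro j <;> exact j.elim0⟩)
      simp only [Finset.sum_singleton, if_true] at this
      refine le_trans ?_ this
      exact_mod_cast hN
    rw [htop]; exact le_top

omit [CompleteSpace E] in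
/-- An operator is compact as soon as, for every `ε > 0`, the orthonormal families on which it is
bounded below by `ε` have bounded size. -/
lemma isCompactOperator_of_orthonormal_bound (K : E →L[ℂ] F)
    (h : ∀ ε : ℝ, 0 < ε → ∃ M : ℕ, ∀ (N : ℕ) (u : Fin N → E), Orthonormal ℂ u →
      (∀ j, ε ≤ ‖K (u j)‖) → N ≤ M) : IsCompactOperator K := by
  classical
  have hcl := isClosed_setOfPred_isCompactOperator (σ₁₂ := RingHom.id ℂ) (M₁ := E) (M₂ := F)
  have : K ∈ closure {f : E →L[ℂ] F | IsCompactOperator f} := by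
    refine Metric.mem_closure_iff.2 fun ε hε => ?_
    obtain ⟨M, hM⟩ := h (ε / 2) (half_pos hε)
    let P : ℕ → Prop := fun N => ∃ u : Fin N → E, Orthonormal ℂ u ∧ ∀ j, ε / 2 ≤ ‖K (u j)‖
    have hP0 : P 0 := ⟨fun j => j.elim0, by constructor <;> intro j <;> exact j.elim0,
      fun j => j.elim0⟩
    -- A family of maximal size: `K` is small on the orthogonal complement of its span, since a
    -- normalized counterexample would enlarge the family. Hence `K` composed with the projection
    -- onto the span is a finite-rank approximation.
    obtain ⟨N, ⟨u, hu, hKu⟩, hmax⟩ : ∃ N, P N ∧ ¬ P (N + 1) := by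
      refine ⟨Nat.findGreatest P M, Nat.findGreatest_spec (Nat.zero_le M) hP0, ?_⟩
      rintro ⟨u', hu', hKu'⟩
      have h1 := hM _ u' hu' hKu'
      exact Nat.findGreatest_is_greatest (Nat.lt_succ_self _) h1 ⟨u', hu', hKu'⟩
    let S : Submodule ℂ E := Submodule.span ℂ (Set.range u)
    have hSf : FiniteDimensional ℂ S := FiniteDimensional.span_of_finite ℂ (Set.finite_range u)
    have hsmall : ∀ w ∈ Sᗮ, ‖K w‖ ≤ ε / 2 * ‖w‖ := by
      intro w hw
      by_contra! hlt
      have hw0 : w ≠ 0 := by rintro rfl; simp at hlt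
      have hwn : 0 < ‖w‖ := norm_pos_iff.2 hw0
      refine hmax ⟨Fin.snoc (α := fun _ => E) u (((‖w‖⁻¹ : ℝ) : ℂ) • w), ?_, ?_⟩
      · have hnorm : ‖((‖w‖⁻¹ : ℝ) : ℂ) • w‖ = 1 := by
          rw [norm_smul, Complex.norm_real, Real.norm_of_nonneg (by positivity),
            inv_mul_cancel₀ hwn.ne']
        have horth : ∀ i, inner ℂ (u i) (((‖w‖⁻¹ : ℝ) : ℂ) • w) = 0 := fun i => by
          rw [inner_smul_right, (Submodule.mem_orthogonal _ _).1 hw _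
            (Submodule.subset_span ⟨i, rfl⟩), mul_zero]
        constructor
        · intro i
          refine Fin.lastCases ?_ (fun i => ?_) i
          · rw [Fin.snoc_last]; exact hnorm
          · rw [Fin.snoc_castSucc]; exact hu.1 i
        · intro i j
          refine Fin.lastCases ?_ (fun i => ?_) i <;> refine Fin.lastCases ?_ (fun j => ?_) j
          · intro hij; exact absurd rfl hij
          · intro _
            simp only [Fin.snoc_last, Fin.snoc_castSucc]
            rw [← inner_conj_symm, horth, map_zero]
          · intro _
            simp only [Fin.snoc_last, Fin.snoc_castSucc]
            exact horth i
          · intro hij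
            simp only [Fin.snoc_castSucc]
            exact hu.2 fun e => hij (congrArg _ e)
      · intro j
        refine Fin.lastCases ?_ (fun j => ?_) j
        · rw [Fin.snoc_last, map_smul, norm_smul, Complex.norm_real,
            Real.norm_of_nonneg (by positivity), inv_mul_eq_div, le_div_iff₀ hwn]
          exact hlt.le
        · rw [Fin.snoc_castSucc]; exact hKu j
    refine ⟨K ∘L S.starProjection, ?_, ?_⟩
    · have : IsCompactOperator (K ∘L S.subtypeL) := by
        have : ProperSpace S := FiniteDimensional.proper ℂ S
        exact isCompactOperator_of_locallyCompactSpace_rng _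
      exact this.comp_clm S.orthogonalProjectionOnto
    · rw [dist_eq_norm]
      refine lt_of_le_of_lt (ContinuousLinearMap.opNorm_le_bound _ (half_pos hε).le fun v => ?_)
        (half_lt_self hε)
      have e : (K - K ∘L S.starProjection) v = K (Sᗮ.starProjection v) := by
        rw [Submodule.starProjection_orthogonal_val]
        simp
      rw [e]
      refine (hsmall _ (Submodule.starProjection_apply_mem _ _)).trans ?_
      gcongr
      exact Submodule.norm_starProjection_apply_le _ _
  exact hcl.closure_subset_iff.2 (fun _ h => h) this

end AbsOp

/-! ### Scalar inequalities: Hölder for sums, geometric Riemann sums, the layer cake formula. -/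

section Scalar

lemma tsum_mul_le_Lp_mul_Lq {ι : Type*} {p q : ℝ} (hpq : p.HolderConjugate q)
    (a b : ι → ℝ≥0∞) :
    ∑' i, a i * b i ≤ (∑' i, a i ^ p) ^ (1 / p) * (∑' i, b i ^ q) ^ (1 / q) := by
  let _ : MeasurableSpace ι := ⊤
  have := ENNReal.lintegral_mul_le_Lp_mul_Lq (Measure.count : Measure ι) hpq
    (f := a) (g := b) (measurable_from_top).aemeasurable (measurable_from_top).aemeasurable
  simpa only [lintegral_count, Pi.mul_apply] using this

lemma iUnion_Ico_zpow {θ : ℝ} (hθ : 1 < θ) :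
    ⋃ m : ℤ, Set.Ico (θ ^ m) (θ ^ (m + 1)) = Set.Ioi 0 := by
  ext x
  simp only [Set.mem_iUnion, Set.mem_Ioi]
  refine ⟨?_, fun hx => exists_mem_Ico_zpow hx hθ⟩
  rintro ⟨m, hm⟩
  exact (zpow_pos (by linarith) m).trans_le hm.1

lemma pairwise_disjoint_Ico_zpow {θ : ℝ} (hθ : 1 < θ) :
    Pairwise (Function.onFun Disjoint fun m : ℤ => Set.Ico (θ ^ m) (θ ^ (m + 1))) :=
  (zpow_right_strictMono₀ hθ).monotone.pairwise_disjoint_on_Ico_succ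

/-- Lower Riemann sums for `∫ 1_{n² e ≤ 1} n² de ≤ 1` over the geometric grid `θ ^ m`. -/
lemma tsum_zpow_weight_le {θ : ℝ} (hθ : 1 < θ) (n : ℝ) :
    ∑' m : ℤ, ENNReal.ofReal (θ ^ (m + 1) - θ ^ m) *
      (if θ ^ (m + 1) * n ^ 2 ≤ 1 then ENNReal.ofReal (n ^ 2) else 0) ≤ 1 := by
  rcases eq_or_ne n 0 with rfl | hn
  · simp
  have hn2 : 0 < n ^ 2 := by positivity
  have h1 : ∀ m : ℤ, ENNReal.ofReal (θ ^ (m + 1) - θ ^ m) *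
      (if θ ^ (m + 1) * n ^ 2 ≤ 1 then ENNReal.ofReal (n ^ 2) else 0) ≤
      ENNReal.ofReal (n ^ 2) *
        (volume.restrict (Set.Ioc 0 (1 / n ^ 2))) (Set.Ico (θ ^ m) (θ ^ (m + 1))) := by
    intro m
    split_ifs with h
    · rw [mul_comm, Measure.restrict_apply measurableSet_Ico, Set.inter_eq_left.2,
        Real.volume_Ico]
      intro x hx
      refine ⟨(zpow_pos (by linarith) m).trans_le hx.1, hx.2.le.trans ?_⟩
      rwa [le_div_iff₀ hn2]
    · simp
  refine (ENNReal.tsum_le_tsum h1).trans ?_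
  rw [ENNReal.tsum_mul_left, ← measure_iUnion (pairwise_disjoint_Ico_zpow hθ)
    (fun _ => measurableSet_Ico)]
  refine (mul_le_mul_right (measure_mono (Set.subset_univ _)) _).trans ?_
  rw [Measure.restrict_apply_univ, Real.volume_Ioc, ← ENNReal.ofReal_mul hn2.le]
  rw [show n ^ 2 * (1 / n ^ 2 - 0) = 1 by field_simp; simp]
  simp

/-- The upper limit is the zero of r - α e^a, so this is the full integral of its squared positive
part; its value fixes the constant of the density estimate. -/
lemma integral_sub_mul_rpow_sq {a r α : ℝ} (ha : 0 < a) (hr : 0 < r) (hα : 0 < α) :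
    ∫ e in (0 : ℝ)..(r / α) ^ (1 / a), (r - α * e ^ a) ^ 2 =
      r ^ 2 * (r / α) ^ (1 / a) * (2 * a ^ 2 / ((a + 1) * (2 * a + 1))) := by
  set E := (r / α) ^ (1 / a) with hE
  have hE0 : 0 < E := by positivity
  have hEa : E ^ a = r / α := by
    rw [hE, ← Real.rpow_mul (by positivity), one_div_mul_cancel ha.ne', Real.rpow_one]
  have hi : ∀ b : ℝ, 0 ≤ b → IntervalIntegrable (fun e : ℝ => e ^ b) volume 0 E := fun b hb =>
    intervalIntegral.intervalIntegrable_rpow' (by linarith)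
  have e1 : ∫ e in (0 : ℝ)..E, (r - α * e ^ a) ^ 2 =
      ∫ e in (0 : ℝ)..E, (r ^ 2 - 2 * r * α * e ^ a + α ^ 2 * e ^ (2 * a)) := by
    refine intervalIntegral.integral_congr fun e he => ?_
    rw [Set.uIcc_of_le hE0.le] at he
    have : e ^ (2 * a) = (e ^ a) ^ 2 := by
      rw [mul_comm, Real.rpow_mul he.1]; norm_cast
    rw [this]; ring
  rw [e1, intervalIntegral.integral_add, intervalIntegral.integral_sub,
    intervalIntegral.integral_const_mul, intervalIntegral.integral_const_mul,
    integral_rpow (Or.inl (by linarith)), integral_rpow (Or.inl (by linarith)),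
    Real.zero_rpow (by linarith), Real.zero_rpow (by linarith),
    intervalIntegral.integral_const, Real.rpow_add hE0, Real.rpow_add hE0, Real.rpow_one,
    mul_comm 2 a, Real.rpow_mul hE0.le, hEa]
  · have h2 : (r / α) ^ (2 : ℝ) = (r / α) ^ 2 := by norm_cast
    rw [h2]
    have : 0 < a * 2 + 1 := by linarith
    field_simp
    ring
  · exact intervalIntegrable_const
  · exact (hi a ha.le).const_mul _
  · exact intervalIntegrable_const.sub ((hi a ha.le).const_mul _)
  · exact (hi (2 * a) (by linarith)).const_mul _

/-- Upper Riemann sums over the geometric grid `θ ^ m` for the integral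
`∫ (r - α e ^ a)₊ ^ 2 de`. -/
lemma rpow_le_tsum_zpow {θ a α : ℝ} (hθ : 1 < θ) (ha : 0 < a) (hα : 0 < α) {r : ℝ} (hr : 0 ≤ r) :
    ENNReal.ofReal (r ^ (2 + 1 / a)) ≤
      ENNReal.ofReal (θ * α ^ (1 / a) * ((a + 1) * (2 * a + 1) / (2 * a ^ 2))) *
        ∑' m : ℤ, ENNReal.ofReal (θ ^ (m + 1) - θ ^ m) *
          ENNReal.ofReal ((max (r - α * (θ ^ (m + 1)) ^ a) 0) ^ 2) := by
  have hθ0 : 0 < θ := by linarith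
  rcases hr.eq_or_lt with rfl | hr
  · rw [Real.zero_rpow (by positivity)]; simp
  set F : ℝ → ℝ := fun e => (max (r - α * e ^ a) 0) ^ 2 with hF
  set E := (r / α) ^ (1 / a) with hE
  have hE0 : 0 < E := by positivity
  have hEa : E ^ a = r / α := by
    rw [hE, ← Real.rpow_mul (by positivity), one_div_mul_cancel ha.ne', Real.rpow_one]
  have h1 : ENNReal.ofReal (r ^ 2 * E * (2 * a ^ 2 / ((a + 1) * (2 * a + 1)))) ≤
      ∫⁻ e in Set.Ioi 0, ENNReal.ofReal (F e) := by
    rw [← integral_sub_mul_rpow_sq ha hr hα, intervalIntegral.integral_of_le hE0.le]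
    have hc : ContinuousOn (fun e : ℝ => (r - α * e ^ a) ^ 2) (Set.Icc 0 E) := by
      refine ContinuousOn.pow (continuousOn_const.sub (continuousOn_const.mul ?_)) 2
      exact ContinuousOn.rpow_const continuousOn_id fun x _ => Or.inr ha.le
    rw [ofReal_integral_eq_lintegral_ofReal
      ((hc.integrableOn_Icc).mono_set Set.Ioc_subset_Icc_self)
      (Filter.Eventually.of_forall fun _ => sq_nonneg _)]
    refine le_trans ?_ (lintegral_mono_set (fun _ h => h.1 : Set.Ioc 0 E ⊆ Set.Ioi 0))
    refine setLIntegral_mono' measurableSet_Ioc fun e he => ?_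
    refine ENNReal.ofReal_le_ofReal ?_
    have : α * e ^ a ≤ r := by
      have h3 : e ^ a ≤ r / α := hEa ▸ Real.rpow_le_rpow he.1.le he.2 ha.le
      rwa [le_div_iff₀ hα, mul_comm] at h3
    simp only [hF]
    rw [max_eq_left (by linarith)]
  -- `F` is decreasing on the positive axis, so its value at the left endpoint dominates each cell.
  have h2 : ∫⁻ e in Set.Ioi 0, ENNReal.ofReal (F e) ≤
      ∑' m : ℤ, ENNReal.ofReal (θ ^ (m + 1) - θ ^ m) * ENNReal.ofReal (F (θ ^ m)) := by
    rw [← iUnion_Ico_zpow hθ, lintegral_iUnion (fun _ => measurableSet_Ico)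
      (pairwise_disjoint_Ico_zpow hθ)]
    refine ENNReal.tsum_le_tsum fun m => ?_
    have hm : 0 < θ ^ m := zpow_pos hθ0 m
    refine (setLIntegral_mono' measurableSet_Ico
      (g := fun _ => ENNReal.ofReal (F (θ ^ m))) fun e he => ?_).trans ?_
    · refine ENNReal.ofReal_le_ofReal (pow_le_pow_left₀ (le_max_right _ _) ?_ 2)
      refine max_le_max ?_ le_rfl
      have := Real.rpow_le_rpow hm.le he.1 ha.le
      nlinarith
    · rw [setLIntegral_const, Real.volume_Ico, mul_comm]
  -- Shifting the index turns left endpoints into right ones; each cell is θ times as wide as its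
  -- predecessor, whence the loss of one factor θ.
  have h3 : ∑' m : ℤ, ENNReal.ofReal (θ ^ (m + 1) - θ ^ m) * ENNReal.ofReal (F (θ ^ m)) =
      ENNReal.ofReal θ * ∑' m : ℤ, ENNReal.ofReal (θ ^ (m + 1) - θ ^ m) *
        ENNReal.ofReal (F (θ ^ (m + 1))) := by
    rw [← ENNReal.tsum_mul_left, ← (Equiv.addRight (1 : ℤ)).tsum_eq]
    refine tsum_congr fun m => ?_
    rw [← mul_assoc, ← ENNReal.ofReal_mul hθ0.le, Equiv.coe_addRight]
    congr 2
    rw [zpow_add_one₀ hθ0.ne' (m + 1), zpow_add_one₀ hθ0.ne' m]; ring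
  have h4 := h1.trans (h2.trans h3.le)
  have h5 : r ^ (2 + 1 / a) = α ^ (1 / a) * ((a + 1) * (2 * a + 1) / (2 * a ^ 2)) *
      (r ^ 2 * E * (2 * a ^ 2 / ((a + 1) * (2 * a + 1)))) := by
    have e2 : α ^ (1 / a) * E = r ^ (1 / a) := by
      rw [hE, Real.div_rpow hr.le hα.le]
      have : α ^ (1 / a) ≠ 0 := (Real.rpow_pos_of_pos hα _).ne'
      field_simp
    rw [Real.rpow_add hr, ← e2]
    have h2 : r ^ (2 : ℝ) = r ^ 2 := by norm_cast
    rw [h2]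
    field_simp
  rw [h5, ENNReal.ofReal_mul (by positivity)]
  refine (mul_le_mul_right h4 _).trans (le_of_eq ?_)
  rw [← mul_assoc, ← ENNReal.ofReal_mul (by positivity)]
  congr 2
  ring

/-- The part of a weak `L^q` function above a threshold is square integrable. -/
lemma setLIntegral_sq_le_of_weak {Y : Type*} [MeasurableSpace Y] (ν : Measure Y) {n : Y → ℝ}
    (hn : Measurable n) (hn0 : ∀ y, 0 ≤ n y) {q : ℝ} (hq : 2 < q) {W : ℝ≥0∞}
    (hW : ∀ τ : ℝ, 0 < τ → ENNReal.ofReal (τ ^ q) * ν {y | τ < n y} ≤ W) {E : ℝ} (hE : 0 < E) :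
    ∫⁻ y in {y | E < n y}, ENNReal.ofReal (n y ^ 2) ∂ν ≤
      W * ENNReal.ofReal (q / (q - 2) * E ^ (2 - q)) := by
  have hW' : ∀ τ : ℝ, 0 < τ → ν {y | τ < n y} ≤ W * ENNReal.ofReal (τ ^ (-q)) := by
    intro τ hτ
    have h := mul_le_mul_left (hW τ hτ) (ENNReal.ofReal (τ ^ (-q)))
    rw [mul_right_comm, ← ENNReal.ofReal_mul (by positivity), ← Real.rpow_add hτ, add_neg_cancel,
      Real.rpow_zero, ENNReal.ofReal_one, one_mul] at h
    exact h
  have h1 := lintegral_rpow_eq_lintegral_meas_lt_mul (ν.restrict {y | E < n y})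
    (Filter.Eventually.of_forall hn0) hn.aemeasurable (p := 2) two_pos
  have h0 : ∀ y, n y ^ (2 : ℝ) = n y ^ 2 := fun y => by norm_cast
  simp_rw [h0] at h1
  -- Below `E` the level sets have at most the measure of {n > E}; above `E` the weak bound applies
  -- at each t. The total is 2 (1/2 + 1/(q-2)) = q/(q-2).
  rw [h1, ← Set.Ioc_union_Ioi_eq_Ioi hE.le, lintegral_union measurableSet_Ioi
    (Set.Ioc_disjoint_Ioi le_rfl)]
  have e1 : ∫⁻ t in Set.Ioc 0 E, (ν.restrict {y | E < n y}) {y | t < n y} *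
      ENNReal.ofReal (t ^ ((2 : ℝ) - 1)) ≤ W * ENNReal.ofReal (E ^ (2 - q) / 2) := by
    have : ∀ t ∈ Set.Ioc 0 E, (ν.restrict {y | E < n y}) {y | t < n y} *
      ENNReal.ofReal (t ^ ((2 : ℝ) - 1)) ≤ W * ENNReal.ofReal (E ^ (-q)) * ENNReal.ofReal t := by
      intro t _
      refine mul_le_mul' (((measure_mono (Set.subset_univ _)).trans
        (Measure.restrict_apply_univ _).le).trans (hW' E hE)) (ENNReal.ofReal_le_ofReal ?_)
      norm_num
    refine (setLIntegral_mono' measurableSet_Ioc this).trans ?_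
    rw [lintegral_const_mul _ (by fun_prop), mul_assoc]
    have e : ∫⁻ t in Set.Ioc 0 E, ENNReal.ofReal t = ENNReal.ofReal (E ^ 2 / 2) := by
      rw [← ofReal_integral_eq_lintegral_ofReal, ← intervalIntegral.integral_of_le hE.le,
        integral_id]
      · simp
      · exact (continuous_id.integrableOn_Icc).mono_set Set.Ioc_subset_Icc_self
      · exact (ae_restrict_mem measurableSet_Ioc).mono fun t ht => ht.1.le
    rw [e, ← ENNReal.ofReal_mul (by positivity)]
    refine le_of_eq ?_
    congr 2
    rw [sub_eq_add_neg, Real.rpow_add hE]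
    have h2 : E ^ (2 : ℝ) = E ^ 2 := by norm_cast
    rw [h2]; ring
  have e2 : ∫⁻ t in Set.Ioi E, (ν.restrict {y | E < n y}) {y | t < n y} *
      ENNReal.ofReal (t ^ ((2 : ℝ) - 1)) ≤ W * ENNReal.ofReal (E ^ (2 - q) / (q - 2)) := by
    have : ∀ t ∈ Set.Ioi E, (ν.restrict {y | E < n y}) {y | t < n y} *
      ENNReal.ofReal (t ^ ((2 : ℝ) - 1)) ≤ W * ENNReal.ofReal (t ^ (1 - q)) := by
      intro t ht
      have ht0 : 0 < t := hE.trans ht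
      refine (mul_le_mul_left ((Measure.restrict_apply_le _ _).trans (hW' t ht0)) _).trans ?_
      rw [mul_assoc, ← ENNReal.ofReal_mul (by positivity), ← Real.rpow_add ht0]
      refine le_of_eq ?_
      congr 3
      ring
    refine (setLIntegral_mono' measurableSet_Ioi this).trans ?_
    rw [lintegral_const_mul _ (by fun_prop), ← ofReal_integral_eq_lintegral_ofReal
      (integrableOn_Ioi_rpow_of_lt (by linarith) hE)
      ((ae_restrict_mem measurableSet_Ioi).mono fun t ht =>
        Real.rpow_nonneg (hE.le.trans (le_of_lt ht)) _),
      integral_Ioi_rpow_of_lt (by linarith) hE]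
    refine le_of_eq ?_
    congr 2
    rw [show 1 - q + 1 = 2 - q by ring, neg_div, ← div_neg, neg_sub]
  refine (mul_le_mul_right (add_le_add e1 e2) _).trans (le_of_eq ?_)
  rw [← mul_add, ← ENNReal.ofReal_add (by positivity)
    (div_nonneg (by positivity) (by linarith)), mul_left_comm, ← ENNReal.ofReal_mul two_pos.le]
  congr 2
  have : q - 2 ≠ 0 := by linarith
  field_simp
  ring

end Scalar

/-! ### The density estimate at a fixed point x. -/

section Pointwise

variable {H : Type*} [NormedAddCommGroup H] [InnerProductSpace ℂ H]

lemma tsum_enorm_inner_sq_le {ι : Type*} {h : ι → H} (hh : Orthonormal ℂ h) (x : H) :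
    ∑' i, ‖inner ℂ (h i) x‖ₑ ^ 2 ≤ ‖x‖ₑ ^ 2 := by
  rw [ENNReal.tsum_eq_iSup_sum]
  refine iSup_le fun s => ?_
  have := ENNReal.ofReal_le_ofReal (hh.sum_inner_products_le x (s := s))
  rw [ENNReal.ofReal_sum_of_nonneg (fun _ _ => by positivity)] at this
  simpa only [ENNReal.ofReal_pow (norm_nonneg _), ofReal_norm] using this

/-- Analysis and synthesis operators are adjoint and have the same norm; concretely, the synthesis
bound is tested on the conjugated coefficients. -/
lemma norm_inner_le_of_forall_norm_sum_le {N : ℕ} {ψ : Fin N → H} {β : ℝ} (hβ : 0 ≤ β)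
    (hψ : ∀ c : EuclideanSpace ℂ (Fin N), ‖∑ j, c j • ψ j‖ ≤ β * ‖c‖) {h : H} (hh : ‖h‖ = 1) :
    ‖(WithLp.toLp 2 fun j => inner ℂ h (ψ j) : EuclideanSpace ℂ (Fin N))‖ ≤ β := by
  set z : EuclideanSpace ℂ (Fin N) := WithLp.toLp 2 fun j => inner ℂ h (ψ j) with hz
  let c : EuclideanSpace ℂ (Fin N) := WithLp.toLp 2 fun j => (starRingEnd ℂ) (inner ℂ h (ψ j))
  have hc : ‖c‖ = ‖z‖ := by
    rw [EuclideanSpace.norm_eq, EuclideanSpace.norm_eq]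
    simp only [c, hz, RCLike.norm_conj]
  have h1 : inner ℂ h (∑ j, c j • ψ j) = ((‖z‖ ^ 2 : ℝ) : ℂ) := by
    rw [inner_sum, EuclideanSpace.norm_sq_eq]
    push_cast
    refine Finset.sum_congr rfl fun j _ => ?_
    rw [inner_smul_right]
    exact RCLike.conj_mul _
  have h2 : ‖z‖ ^ 2 ≤ β * ‖z‖ := by
    have := norm_inner_le_norm (𝕜 := ℂ) h (∑ j, c j • ψ j)
    rw [h1, hh, one_mul, Complex.norm_real, Real.norm_of_nonneg (by positivity)] at this
    exact this.trans (hc ▸ hψ c)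
  rcases (norm_nonneg z).eq_or_lt with h0 | h0
  · rwa [← h0]
  · nlinarith

variable [CompleteSpace H]

/-- The constant of the pointwise density estimate. -/
def ruminConst (θ q α : ℝ) : ℝ :=
  θ * α ^ (1 / ((q - 2) / 4)) *
    (((q - 2) / 4 + 1) * (2 * ((q - 2) / 4) + 1) / (2 * ((q - 2) / 4) ^ 2))

/-- Along each right singular vector of `f`, the high parts have length at most α e^a, so the low
parts carry the rest; summing over the grid bounds a power of the density `ρ`. Hölder against the
squared singular values then combines the directions. -/
lemma sum_enorm_apply_sq_le {q θ α : ℝ} (hq : 2 < q) (hθ : 1 < θ) (hα : 0 < α) {f : H →L[ℂ] H}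
    (hf : IsCompactOperator f) {N : ℕ} (φ : Fin N → H) (lo : ℤ → Fin N → H)
    (hhi : ∀ (m : ℤ) (c : EuclideanSpace ℂ (Fin N)),
      ‖∑ j, c j • (φ j - lo m j)‖ ≤ α * (θ ^ (m + 1)) ^ ((q - 2) / 4) * ‖c‖) :
    ∑ j, ‖f (φ j)‖ₑ ^ 2 ≤ schattenNorm q f ^ (2 : ℝ) *
      (ENNReal.ofReal (ruminConst θ q α) * ∑' m : ℤ, ENNReal.ofReal (θ ^ (m + 1) - θ ^ m) *
        ∑ j, ‖lo m j‖ₑ ^ 2) ^ (1 - 2 / q) := by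
  have hq0 : 0 < q := by linarith
  have hq2 : 0 < q - 2 := by linarith
  obtain ⟨n, h, hn, hh, hK⟩ := exists_singular_family hf
  let ρ : (Σ s : Set.Ioi (0 : ℝ), Fin (n s)) → ℝ≥0∞ := fun i => ∑ j, ‖inner ℂ (h i) (φ j)‖ₑ ^ 2
  have hlhs : ∑ j, ‖f (φ j)‖ₑ ^ 2 = ∑' i, ENNReal.ofReal i.1 ^ 2 * ρ i := by
    simp_rw [hK, ρ, Finset.mul_sum]
    rw [Summable.tsum_finsetSum fun _ _ => ENNReal.summable]
  have hpq : (q / 2).HolderConjugate (q / (q - 2)) := by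
    rw [Real.holderConjugate_iff]
    refine ⟨by linarith, ?_⟩
    field_simp
    ring
  have hvec : ∀ (i) (ψ : Fin N → H), ∑ j, ‖inner ℂ (h i) (ψ j)‖ₑ ^ 2 = ENNReal.ofReal
      (‖(WithLp.toLp 2 fun j => inner ℂ (h i) (ψ j) : EuclideanSpace ℂ (Fin N))‖ ^ 2) := by
    intro i ψ
    rw [EuclideanSpace.norm_sq_eq, ENNReal.ofReal_sum_of_nonneg fun _ _ => by positivity]
    refine Finset.sum_congr rfl fun j _ => ?_
    rw [ENNReal.ofReal_pow (norm_nonneg _), ofReal_norm]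
  have hρ : ∀ i, ρ i ^ (q / (q - 2)) ≤ ENNReal.ofReal (ruminConst θ q α) *
      ∑' m : ℤ, ENNReal.ofReal (θ ^ (m + 1) - θ ^ m) * ∑ j, ‖inner ℂ (h i) (lo m j)‖ₑ ^ 2 := by
    intro i
    set r := ‖(WithLp.toLp 2 fun j => inner ℂ (h i) (φ j) : EuclideanSpace ℂ (Fin N))‖ with hr
    -- With a = (q-2)/4 one has 2 + 1/a = 2q/(q-2), so the power produced by the scalar integral is
    -- exactly the Hölder-conjugate power of ρ = r².
    have e1 : ρ i ^ (q / (q - 2)) = ENNReal.ofReal (r ^ (2 + 1 / ((q - 2) / 4))) := by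
      have hr2 : ρ i = ENNReal.ofReal (r ^ 2) := hvec i φ
      rw [hr2, ENNReal.ofReal_rpow_of_nonneg (by positivity) (by positivity), ← Real.rpow_natCast,
        ← Real.rpow_mul (norm_nonneg _)]
      congr 2
      push_cast
      field_simp
      ring
    rw [e1]
    refine (rpow_le_tsum_zpow hθ (by positivity) hα (norm_nonneg _)).trans ?_
    refine mul_le_mul_right (ENNReal.tsum_le_tsum fun m => mul_le_mul_right ?_ _) _
    rw [hvec]
    refine ENNReal.ofReal_le_ofReal (pow_le_pow_left₀ (le_max_right _ _) ?_ 2)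
    refine max_le ?_ (norm_nonneg _)
    have h1 := norm_inner_le_of_forall_norm_sum_le (by positivity) (hhi m) (hh.1 i)
    have h2 : (WithLp.toLp 2 fun j => inner ℂ (h i) (φ j) : EuclideanSpace ℂ (Fin N)) =
        WithLp.toLp 2 (fun j => inner ℂ (h i) (lo m j)) +
          WithLp.toLp 2 (fun j => inner ℂ (h i) (φ j - lo m j)) := by
      ext j; simp
    have h3 := norm_add_le (WithLp.toLp 2 (fun j => inner ℂ (h i) (lo m j)) :
      EuclideanSpace ℂ (Fin N)) (WithLp.toLp 2 (fun j => inner ℂ (h i) (φ j - lo m j)))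
    rw [← h2] at h3
    linarith
  rw [hlhs]
  refine (tsum_mul_le_Lp_mul_Lq hpq _ _).trans ?_
  refine mul_le_mul' (le_of_eq ?_) ?_
  · have e2 : schattenNorm q f ^ (2 : ℝ) = (schattenNorm q f ^ q) ^ (1 / (q / 2)) := by
      rw [← ENNReal.rpow_mul]
      congr 1
      field_simp
    rw [e2, schattenNorm_rpow hq0 f hn]
    congr 1
    refine tsum_congr fun i => ?_
    rw [← ENNReal.rpow_natCast, ← ENNReal.rpow_mul]
    congr 1
    push_cast
    ring
  · rw [show 1 / (q / (q - 2)) = 1 - 2 / q by field_simp]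
    refine ENNReal.rpow_le_rpow ?_ (by rw [sub_nonneg, div_le_one hq0]; linarith)
    refine (ENNReal.tsum_le_tsum hρ).trans ?_
    rw [ENNReal.tsum_mul_left, ENNReal.tsum_comm]
    refine mul_le_mul_right (ENNReal.tsum_le_tsum fun m => ?_) _
    rw [ENNReal.tsum_mul_left]
    refine mul_le_mul_right ?_ _
    rw [Summable.tsum_finsetSum fun _ _ => ENNReal.summable]
    exact Finset.sum_le_sum fun j _ => tsum_enorm_inner_sq_le hh _

end Pointwise

/-! ### Measurability of operator-valued functions. -/

section Measurability

variable {X H : Type*} [MeasurableSpace X] [NormedAddCommGroup H] [InnerProductSpace ℂ H]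
  {μ : Measure X}

/-- Approximating `u` by simple functions reduces this to finitely many orbit maps at a time;
continuity of each `f x` gives the limit. -/
lemma OpMeasurable.apply {f : X → H →L[ℂ] H} (hf : OpMeasurable f μ) {u : X → H}
    (hu : AEStronglyMeasurable u μ) : AEStronglyMeasurable (fun x => f x (u x)) μ := by
  classical
  suffices h : AEStronglyMeasurable (fun x => f x (hu.mk u x)) μ by
    refine h.congr ?_
    filter_upwards [hu.ae_eq_mk] with x hx
    rw [hx]
  have hs := hu.stronglyMeasurable_mk
  refine aestronglyMeasurable_of_tendsto_ae (u := Filter.atTop)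
    (f := fun n x => f x (hs.approx n x)) (fun n => ?_)
    (Filter.Eventually.of_forall fun x =>
      ((f x).continuous.tendsto _).comp (hs.tendsto_approx x))
  have h1 : (fun x => f x (hs.approx n x)) = fun x => ∑ c ∈ (hs.approx n).range,
      (hs.approx n ⁻¹' {c}).indicator (fun x => f x c) x := by
    funext x
    rw [Finset.sum_eq_single (hs.approx n x)]
    · rw [Set.indicator_of_mem (by simp)]
    · intro c _ hc
      rw [Set.indicator_of_notMem]
      simpa using hc.symm
    · intro h
      exact absurd (SimpleFunc.mem_range_self _ _) h
  rw [h1]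
  exact Finset.aestronglyMeasurable_fun_sum _ fun c _ =>
    (hf c).indicator (SimpleFunc.measurableSet_fiber _ _)

lemma enorm_eq_iSup_denseSeq [TopologicalSpace.SeparableSpace H] (T : H →L[ℂ] H) :
    ‖T‖ₑ = ⨆ n, ‖T (TopologicalSpace.denseSeq H n)‖ₑ / ‖TopologicalSpace.denseSeq H n‖ₑ := by
  set d := TopologicalSpace.denseSeq H
  refine le_antisymm ?_ (iSup_le fun n => ENNReal.div_le_of_le_mul (T.le_opENorm _))
  set M := ⨆ n, ‖T (d n)‖ₑ / ‖d n‖ₑ with hM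
  rcases eq_or_ne M ∞ with hMt | hMt
  · rw [hMt]; exact le_top
  have h1 : ∀ v, ‖T v‖ ≤ M.toReal * ‖v‖ := by
    intro v
    refine (TopologicalSpace.denseRange_denseSeq H).induction_on
      (p := fun v => ‖T v‖ ≤ M.toReal * ‖v‖) v
      (isClosed_le (by fun_prop) (by fun_prop)) fun n => ?_
    have h2 : ‖T (d n)‖ₑ / ‖d n‖ₑ ≤ M := le_iSup (fun n => ‖T (d n)‖ₑ / ‖d n‖ₑ) n
    rcases eq_or_ne (d n) 0 with h0 | h0
    · change ‖T (d n)‖ ≤ M.toReal * ‖d n‖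
      rw [h0]; simp
    · rw [ENNReal.div_le_iff (by simpa using h0) enorm_ne_top] at h2
      have := ENNReal.toReal_mono (ENNReal.mul_ne_top hMt enorm_ne_top) h2
      rwa [ENNReal.toReal_mul, toReal_enorm, toReal_enorm] at this
  have h3 := ENNReal.ofReal_le_ofReal (T.opNorm_le_bound ENNReal.toReal_nonneg h1)
  rwa [ofReal_norm, ENNReal.ofReal_toReal hMt] at h3

lemma OpMeasurable.aemeasurable_enorm [TopologicalSpace.SeparableSpace H] {f : X → H →L[ℂ] H}
    (hf : OpMeasurable f μ) : AEMeasurable (fun x => ‖f x‖ₑ) μ := by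
  simp_rw [enorm_eq_iSup_denseSeq]
  exact AEMeasurable.iSup fun n => (hf _).enorm.div_const _

lemma OpMeasurable.exists_measurable_norm [TopologicalSpace.SeparableSpace H] {f : X → H →L[ℂ] H}
    (hf : OpMeasurable f μ) :
    ∃ n : X → ℝ, Measurable n ∧ (∀ x, 0 ≤ n x) ∧ ∀ᵐ x ∂μ, ‖f x‖ = n x := by
  have h := hf.aemeasurable_enorm
  refine ⟨fun x => (h.mk _ x).toReal, h.measurable_mk.ennreal_toReal,
    fun _ => ENNReal.toReal_nonneg, ?_⟩
  filter_upwards [h.ae_eq_mk] with x hx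
  rw [← hx, toReal_enorm]

end Measurability

/-! ### L² computations and the L¹ to L^∞ bound for the adjoint. -/

section Lp

variable {X Y H G : Type*} [MeasurableSpace X] [MeasurableSpace Y]
  [NormedAddCommGroup H] [InnerProductSpace ℂ H] [NormedAddCommGroup G] [InnerProductSpace ℂ G]
  {μ : Measure X} {ν : Measure Y}

omit [InnerProductSpace ℂ H] in
lemma eLpNorm_two_sq (u : X → H) : eLpNorm u 2 μ ^ 2 = ∫⁻ x, ‖u x‖ₑ ^ 2 ∂μ := by
  rw [eLpNorm_eq_lintegral_rpow_enorm_toReal two_ne_zero ENNReal.ofNat_ne_top,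
    ENNReal.toReal_ofNat, ← ENNReal.rpow_natCast, ← ENNReal.rpow_mul]
  norm_num

omit [InnerProductSpace ℂ H] in
lemma Lp_enorm_sq (u : Lp H 2 μ) : ‖u‖ₑ ^ 2 = ∫⁻ x, ‖u x‖ₑ ^ 2 ∂μ := by
  rw [Lp.enorm_def, eLpNorm_two_sq]

lemma Lp_coeFn_sum_smul {N : ℕ} (c : Fin N → ℂ) (v : Fin N → Lp H 2 μ) :
    (∑ j, c j • v j : Lp H 2 μ) =ᵐ[μ] fun x => ∑ j, c j • v j x := by
  have h : ∀ s : Finset (Fin N),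
      (∑ j ∈ s, c j • v j : Lp H 2 μ) =ᵐ[μ] fun x => ∑ j ∈ s, c j • v j x := by
    classical
    intro s
    induction s using Finset.induction_on with
    | empty =>
      simp only [Finset.sum_empty]
      exact Lp.coeFn_zero H 2 μ
    | insert a s ha ih =>
      rw [Finset.sum_insert ha]
      filter_upwards [Lp.coeFn_add (c a • v a) (∑ j ∈ s, c j • v j), Lp.coeFn_smul (c a) (v a), ih]
        with x h1 h2 h3
      rw [h1, Pi.add_apply, h2, h3, Pi.smul_apply, Finset.sum_insert ha]
  exact h _

lemma eLpNorm_le_oneInftyNorm_mul (Φ : Lp H 2 μ ≃ₗᵢ[ℂ] Lp G 2 ν) {u : Lp H 2 μ}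
    (hu : MemLp u 1 μ) : eLpNorm (Φ u) ∞ ν ≤ oneInftyNorm Φ * eLpNorm u 1 μ := by
  rcases eq_or_ne (eLpNorm u 1 μ) 0 with h0 | h0
  · have hu0 : u = 0 := by
      rw [eLpNorm_eq_zero_iff (Lp.aestronglyMeasurable u) one_ne_zero] at h0
      exact Lp.ext (h0.trans (Lp.coeFn_zero H 2 μ).symm)
    rw [hu0, map_zero, eLpNorm_congr_ae (Lp.coeFn_zero G 2 ν), eLpNorm_zero]
    exact zero_le
  · rw [← ENNReal.div_le_iff h0 hu.2.ne]
    exact le_sInf fun C hC => ENNReal.div_le_of_le_mul (hC u hu)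

lemma enorm_inner_le {v w : Lp G 2 ν} :
    ‖(inner ℂ v w : ℂ)‖ₑ ≤ eLpNorm v 1 ν * eLpNorm w ∞ ν := by
  rw [L2.inner_def, eLpNorm_one_eq_lintegral_enorm,
    ← lintegral_mul_const'' _ (Lp.aestronglyMeasurable v).enorm]
  refine (enorm_integral_le_lintegral_enorm _).trans (lintegral_mono_ae ?_)
  filter_upwards [ae_le_eLpNormEssSup (f := w) (μ := ν)] with y hy
  rw [eLpNorm_exponent_top]
  refine le_trans ?_ (mul_le_mul_right hy _)
  rw [← ofReal_norm, ← ofReal_norm (v y), ← ofReal_norm (w y), ← ENNReal.ofReal_mul (norm_nonneg _)]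
  exact ENNReal.ofReal_le_ofReal (norm_inner_le_norm _ _)

/-- The adjoint of a unitary that is bounded from `L¹` to `L^∞` is so, too. -/
lemma ae_enorm_symm_le (Φ : Lp H 2 μ ≃ₗᵢ[ℂ] Lp G 2 ν) (hΦ : oneInftyNorm Φ < ∞) {v : Lp G 2 ν}
    (hv : MemLp v 1 ν) :
    ∀ᵐ x ∂μ, ‖Φ.symm v x‖ₑ ≤ oneInftyNorm Φ * eLpNorm v 1 ν := by
  set M := oneInftyNorm Φ * eLpNorm v 1 ν with hM
  have hMt : M ≠ ∞ := ENNReal.mul_ne_top hΦ.ne hv.2.ne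
  set φ := Φ.symm v with hφ
  -- Duality: `v` is paired with Φ applied to the restriction of `φ` to `S`. That restriction lies
  -- in L¹ because `S` has finite measure, and (M + δ) I ≤ M I then forces I = 0.
  have key : ∀ δ : ℝ≥0∞, 0 < δ → δ ≠ ∞ → μ {x | M + δ ≤ ‖φ x‖ₑ} = 0 := by
    intro δ hδ hδt
    set S := {x | M + δ ≤ ‖φ x‖ₑ} with hS
    have hSm : MeasurableSet S :=
      measurableSet_le measurable_const (Lp.stronglyMeasurable φ).enorm
    have hSf : μ S < ∞ := (Lp.memLp φ).meas_ge_lt_top'_enorm two_ne_zero ENNReal.ofNat_ne_top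
      (by simp [hδ.ne']) (by simp [hMt, hδt])
    have hu2 : MemLp (S.indicator φ) 2 μ := (Lp.memLp φ).indicator hSm
    set u := hu2.toLp with hu
    have hue : u =ᵐ[μ] S.indicator φ := hu2.coeFn_toLp
    have hu1 : MemLp u 1 μ := by
      refine MemLp.ae_eq hue.symm ((memLp_indicator_iff_restrict hSm).2 ?_)
      have : IsFiniteMeasure (μ.restrict S) := ⟨by simpa using hSf⟩
      exact ((Lp.memLp φ).restrict S).mono_exponent (by norm_num)
    have hI : eLpNorm u 1 μ = ∫⁻ x in S, ‖φ x‖ₑ ∂μ := by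
      rw [eLpNorm_congr_ae hue, eLpNorm_one_eq_lintegral_enorm, ← lintegral_indicator hSm]
      simp_rw [enorm_indicator_eq_indicator_enorm]
    have h1 : ‖(inner ℂ v (Φ u) : ℂ)‖ₑ ≤ M * ∫⁻ x in S, ‖φ x‖ₑ ∂μ := by
      refine enorm_inner_le.trans ((mul_le_mul_right (eLpNorm_le_oneInftyNorm_mul Φ hu1) _).trans ?_)
      rw [hI, hM, ← mul_assoc, mul_comm (eLpNorm v 1 ν)]
    have h2 : (inner ℂ v (Φ u) : ℂ) = inner ℂ u u := by
      have : v = Φ φ := by rw [hφ, Φ.apply_symm_apply]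
      rw [this, Φ.inner_map_map, L2.inner_def, L2.inner_def]
      refine integral_congr_ae ?_
      filter_upwards [hue] with x hx
      rw [hx]
      by_cases hxS : x ∈ S
      · rw [Set.indicator_of_mem hxS]
      · rw [Set.indicator_of_notMem hxS, inner_zero_right, inner_zero_right]
    have h3 : ‖(inner ℂ u u : ℂ)‖ₑ = ∫⁻ x in S, ‖φ x‖ₑ ^ 2 ∂μ := by
      rw [inner_self_eq_norm_sq_to_K, enorm_pow]
      have : ‖((‖u‖ : ℝ) : ℂ)‖ₑ = ‖u‖ₑ := by
        rw [← ofReal_norm, Complex.norm_real, norm_norm, ofReal_norm]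
      erw [this]
      rw [Lp_enorm_sq, ← lintegral_indicator hSm]
      refine lintegral_congr_ae ?_
      filter_upwards [hue] with x hx
      rw [hx]
      by_cases hxS : x ∈ S
      · rw [Set.indicator_of_mem hxS, Set.indicator_of_mem hxS]
      · rw [Set.indicator_of_notMem hxS, Set.indicator_of_notMem hxS]; simp
    have h4 : (M + δ) * ∫⁻ x in S, ‖φ x‖ₑ ∂μ ≤ ∫⁻ x in S, ‖φ x‖ₑ ^ 2 ∂μ := by
      rw [← lintegral_const_mul _ (Lp.stronglyMeasurable φ).enorm]
      refine setLIntegral_mono' hSm fun x hx => ?_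
      rw [sq]
      exact mul_le_mul_left hx _
    set I := ∫⁻ x in S, ‖φ x‖ₑ ∂μ with hIdef
    have hIt : I ≠ ∞ := hI ▸ hu1.2.ne
    have h5 : (M + δ) * I ≤ M * I := h4.trans (h3 ▸ h2 ▸ h1)
    have h6 : I = 0 := by
      by_contra hI0
      rw [ENNReal.mul_le_mul_iff_left hI0 hIt] at h5
      exact (ENNReal.lt_add_right hMt hδ.ne').not_ge h5
    have h7 : δ * μ S ≤ I := by
      rw [hIdef, ← setLIntegral_const]
      exact setLIntegral_mono' hSm fun x hx => le_add_self.trans hx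
    rw [h6] at h7
    simpa [hδ.ne'] using h7
  have h8 : ∀ᵐ x ∂μ, ∀ k : ℕ, ‖φ x‖ₑ < M + ((k : ℝ≥0∞) + 1)⁻¹ := by
    rw [ae_all_iff]
    intro k
    have := key ((k : ℝ≥0∞) + 1)⁻¹ (by simp) (by simp)
    rw [ae_iff]
    simpa using this
  filter_upwards [h8] with x hx
  refine ENNReal.le_of_forall_pos_le_add fun ε hε _ => ?_
  obtain ⟨k, hk⟩ := ENNReal.exists_inv_nat_lt (a := (ε : ℝ≥0∞)) (by simpa using hε.ne')
  refine (hx k).le.trans (add_le_add le_rfl (le_trans ?_ hk.le))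
  exact ENNReal.inv_le_inv.2 le_self_add

end Lp

/-! ### The density estimate integrated over X. -/

section Integrated

/-- Hölder's inequality, when the factor `S` of a pointwise bound is possibly not measurable. -/
lemma lintegral_le_of_ae_le_mul {X : Type*} [MeasurableSpace X] {μ : Measure X} {q : ℝ}
    (hq : 2 < q) {F G S : X → ℝ≥0∞} (hF : AEMeasurable F μ) (hG : AEMeasurable G μ)
    (hGt : ∫⁻ x, G x ∂μ ≠ ∞) (h : ∀ᵐ x ∂μ, F x ≤ S x ^ (2 : ℝ) * G x ^ (1 - 2 / q)) :
    ∫⁻ x, F x ∂μ ≤ ((∫⁻ x, S x ^ q ∂μ) ^ (1 / q)) ^ (2 : ℝ) * (∫⁻ x, G x ∂μ) ^ (1 - 2 / q) := by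
  have hq0 : 0 < q := by linarith
  have hq2 : 0 < q - 2 := by linarith
  have hr : 0 < 1 - 2 / q := by rw [sub_pos, div_lt_one hq0]; exact hq
  have hpq : (q / 2).HolderConjugate (q / (q - 2)) := by
    rw [Real.holderConjugate_iff]
    refine ⟨by linarith, ?_⟩
    field_simp
    ring
  -- The measurable quotient F / G^(1-2/q) takes the place of S² in Hölder. It is harmless where G =
  -- 0, since F vanishes there, and G is finite almost everywhere.
  have h1 : ∫⁻ x, F x ∂μ ≤ ∫⁻ x, (F x / G x ^ (1 - 2 / q)) * G x ^ (1 - 2 / q) ∂μ := by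
    refine lintegral_mono_ae ?_
    filter_upwards [h, ae_lt_top' hG hGt] with x hx hxt
    rcases eq_or_ne (G x) 0 with h0 | h0
    · rw [h0, ENNReal.zero_rpow_of_pos hr, mul_zero] at hx
      exact hx.trans zero_le
    · rw [ENNReal.div_mul_cancel]
      · exact fun h => h0 ((ENNReal.rpow_eq_zero_iff_of_pos hr).1 h)
      · exact ENNReal.rpow_ne_top_of_nonneg hr.le hxt.ne
  refine h1.trans ((ENNReal.lintegral_mul_le_Lp_mul_Lq μ hpq (hF.div (hG.pow_const _))
    (hG.pow_const _)).trans ?_)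
  have e1 : 1 / (q / (q - 2)) = 1 - 2 / q := by field_simp
  refine mul_le_mul' ?_ (le_of_eq ?_)
  · rw [← ENNReal.rpow_mul, show 1 / q * 2 = 1 / (q / 2) by field_simp]
    refine ENNReal.rpow_le_rpow (lintegral_mono_ae ?_) (by positivity)
    filter_upwards [h] with x hx
    refine (ENNReal.rpow_le_rpow (ENNReal.div_le_of_le_mul hx) (by positivity)).trans (le_of_eq ?_)
    rw [← ENNReal.rpow_mul]
    congr 1
    field_simp
  · rw [e1]
    congr 1
    refine lintegral_congr fun x => ?_
    rw [← ENNReal.rpow_mul, show (1 - 2 / q) * (q / (q - 2)) = 1 by field_simp, ENNReal.rpow_one]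

variable {X Y H G : Type*} [MeasurableSpace X] [MeasurableSpace Y]
  [NormedAddCommGroup H] [InnerProductSpace ℂ H]
  [NormedAddCommGroup G] [InnerProductSpace ℂ G]
  {μ : Measure X} {ν : Measure Y}

/-- Families whose synthesis operator is a contraction. -/
def IsBessel {E : Type*} [NormedAddCommGroup E] [InnerProductSpace ℂ E] {N : ℕ}
    (u : Fin N → E) : Prop :=
  ∀ c : EuclideanSpace ℂ (Fin N), ‖∑ j, c j • u j‖ ≤ ‖c‖

lemma IsBessel.norm_le_one {E : Type*} [NormedAddCommGroup E] [InnerProductSpace ℂ E] {N : ℕ}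
    {u : Fin N → E} (hu : IsBessel u) (j : Fin N) : ‖u j‖ ≤ 1 := by
  classical
  have := hu (EuclideanSpace.single j 1)
  simpa [Pi.single_apply, ite_smul] using this

lemma norm_sum_smul_of_orthonormal {E : Type*} [NormedAddCommGroup E] [InnerProductSpace ℂ E] {N : ℕ}
    {u : Fin N → E} (hu : Orthonormal ℂ u) (c : EuclideanSpace ℂ (Fin N)) :
    ‖∑ j, c j • u j‖ = ‖c‖ := by
  have h := hu.inner_sum c c Finset.univ
  rw [inner_self_eq_norm_sq_to_K] at h
  have h2 : ‖∑ j, c j • u j‖ ^ 2 = ‖c‖ ^ 2 := by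
    rw [EuclideanSpace.norm_sq_eq]
    have h3 : ∀ j, (starRingEnd ℂ) (c j) * c j = ((‖c j‖ ^ 2 : ℝ) : ℂ) := fun j => by
      rw [RCLike.conj_mul]; push_cast; rfl
    simp_rw [h3] at h
    refine Complex.ofReal_injective ?_
    push_cast at h ⊢
    exact h
  exact (sq_eq_sq₀ (norm_nonneg _) (norm_nonneg _)).1 h2

/-- For fixed `c`, Cauchy–Schwarz on `B` bounds the L¹ norm of ∑ c_j v_j by (∫_B ‖g‖²)^(1/2) ‖c‖,
and the adjoint of Φ sends L¹ to L^∞. A countable dense set of `c` yields one null set for all. -/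
lemma ae_norm_sum_symm_le [TopologicalSpace.SeparableSpace G]
    (Φ : Lp H 2 μ ≃ₗᵢ[ℂ] Lp G 2 ν) (hΦ : oneInftyNorm Φ < ∞)
    {g : Y → G →L[ℂ] G} (hg : OpMeasurable g ν) {N : ℕ} {u : Fin N → Lp G 2 ν}
    (hu : IsBessel u) {B : Set Y} (hB : MeasurableSet B) (hBt : ∫⁻ y in B, ‖g y‖ₑ ^ 2 ∂ν ≠ ∞)
    {β : ℝ} (hβ : oneInftyNorm Φ ^ 2 * ∫⁻ y in B, ‖g y‖ₑ ^ 2 ∂ν ≤ ENNReal.ofReal (β ^ 2))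
    (hβ0 : 0 ≤ β)
    {v : Fin N → Lp G 2 ν} (hv : ∀ j, v j =ᵐ[ν] B.indicator fun y => g y (u j y)) :
    ∀ᵐ x ∂μ, ∀ c : EuclideanSpace ℂ (Fin N), ‖∑ j, c j • Φ.symm (v j) x‖ ≤ β * ‖c‖ := by
  have key : ∀ c : EuclideanSpace ℂ (Fin N),
      ∀ᵐ x ∂μ, ‖∑ j, c j • Φ.symm (v j) x‖ ≤ β * ‖c‖ := by
    intro c
    set w := ∑ j, c j • v j with hw
    set z := ∑ j, c j • u j with hz
    have hwz : w =ᵐ[ν] B.indicator fun y => g y (z y) := by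
      filter_upwards [Lp_coeFn_sum_smul c v, Lp_coeFn_sum_smul c u, ae_all_iff.2 hv]
        with y h1 h2 h3
      rw [hw, h1]
      simp_rw [h3]
      by_cases hy : y ∈ B
      · simp_rw [Set.indicator_of_mem hy]
        rw [hz, h2, map_sum]
        simp_rw [map_smul]
      · simp_rw [Set.indicator_of_notMem hy, smul_zero, Finset.sum_const_zero]
    have hw1 : eLpNorm w 1 ν ≤ (∫⁻ y in B, ‖g y‖ₑ ^ 2 ∂ν) ^ (1 / (2 : ℝ)) * ‖c‖ₑ := by
      have e1 : eLpNorm w 1 ν = ∫⁻ y in B, ‖g y (z y)‖ₑ ∂ν := by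
        rw [eLpNorm_congr_ae hwz, eLpNorm_one_eq_lintegral_enorm, ← lintegral_indicator hB]
        simp_rw [enorm_indicator_eq_indicator_enorm]
      rw [e1]
      refine (lintegral_mono fun y => (g y).le_opENorm (z y)).trans ?_
      refine (ENNReal.lintegral_mul_le_Lp_mul_Lq _ Real.HolderConjugate.two_two
        hg.aemeasurable_enorm.restrict (Lp.aestronglyMeasurable z).enorm.restrict).trans ?_
      simp_rw [ENNReal.rpow_two]
      refine mul_le_mul' le_rfl ?_
      refine (ENNReal.rpow_le_rpow (setLIntegral_le_lintegral _ _) (by positivity)).trans ?_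
      rw [← Lp_enorm_sq, ← ENNReal.rpow_natCast, ← ENNReal.rpow_mul]
      norm_num
      rw [← ofReal_norm, ← ofReal_norm]
      exact ENNReal.ofReal_le_ofReal (hu c)
    have hwL : MemLp w 1 ν := by
      refine ⟨Lp.aestronglyMeasurable w, hw1.trans_lt ?_⟩
      exact ENNReal.mul_lt_top (ENNReal.rpow_lt_top_of_nonneg (by positivity) hBt) enorm_lt_top
    have hT : Φ.symm w = ∑ j, c j • Φ.symm (v j) := by
      rw [hw, map_sum]; simp_rw [map_smul]
    have hb : oneInftyNorm Φ * (∫⁻ y in B, ‖g y‖ₑ ^ 2 ∂ν) ^ (1 / (2 : ℝ)) ≤ ENNReal.ofReal β := by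
      have := ENNReal.rpow_le_rpow hβ (z := 1 / 2) (by positivity)
      rw [ENNReal.mul_rpow_of_nonneg _ _ (by positivity), ENNReal.ofReal_pow hβ0,
        ← ENNReal.rpow_natCast, ← ENNReal.rpow_natCast, ← ENNReal.rpow_mul,
        ← ENNReal.rpow_mul] at this
      norm_num at this
      norm_num
      exact this
    filter_upwards [ae_enorm_symm_le Φ hΦ hwL, Lp_coeFn_sum_smul c fun j => Φ.symm (v j)]
      with x h1 h2
    rw [hT, h2] at h1
    have h3 := h1.trans (mul_le_mul_right hw1 _)
    rw [← mul_assoc] at h3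
    replace h3 := h3.trans (mul_le_mul_left hb _)
    rw [← ofReal_norm, ← ofReal_norm, ← ENNReal.ofReal_mul hβ0,
      ENNReal.ofReal_le_ofReal_iff (by positivity)] at h3
    exact h3
  have h := ae_all_iff.2 fun k => key (TopologicalSpace.denseSeq (EuclideanSpace ℂ (Fin N)) k)
  filter_upwards [h] with x hx c
  refine (TopologicalSpace.denseRange_denseSeq (EuclideanSpace ℂ (Fin N))).induction_on
    (p := fun c => ‖∑ j, c j • Φ.symm (v j) x‖ ≤ β * ‖c‖) c
    (isClosed_le (by fun_prop) (by fun_prop)) hx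

/-- Exchanging sum and integral leaves, at each y, the weight sum of `tsum_zpow_weight_le`, which is
at most 1. -/
lemma tsum_weight_enorm_sq_le {θ : ℝ} (hθ : 1 < θ) {g : Y → G →L[ℂ] G} {n : Y → ℝ}
    (hn : Measurable n) (hgn : ∀ᵐ y ∂ν, ‖g y‖ = n y) (u : Lp G 2 ν) {lo : ℤ → Lp G 2 ν}
    (hlo : ∀ m, lo m =ᵐ[ν] {y | θ ^ (m + 1) * n y ^ 2 ≤ 1}.indicator fun y => g y (u y)) :
    ∑' m : ℤ, ENNReal.ofReal (θ ^ (m + 1) - θ ^ m) * ‖lo m‖ₑ ^ 2 ≤ ‖u‖ₑ ^ 2 := by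
  have h1 : ∀ m, ENNReal.ofReal (θ ^ (m + 1) - θ ^ m) * ‖lo m‖ₑ ^ 2 ≤
      ∫⁻ y, (ENNReal.ofReal (θ ^ (m + 1) - θ ^ m) *
        (if θ ^ (m + 1) * n y ^ 2 ≤ 1 then ENNReal.ofReal (n y ^ 2) else 0)) * ‖u y‖ₑ ^ 2 ∂ν := by
    intro m
    rw [Lp_enorm_sq, ← lintegral_const_mul _ ((Lp.stronglyMeasurable (lo m)).enorm.pow_const _)]
    refine lintegral_mono_ae ?_
    filter_upwards [hlo m, hgn] with y h1 h2
    rw [h1, mul_assoc]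
    refine mul_le_mul_right ?_ _
    by_cases hy : θ ^ (m + 1) * n y ^ 2 ≤ 1
    · rw [Set.indicator_of_mem (by exact hy), if_pos hy, ← h2, ENNReal.ofReal_pow (norm_nonneg _),
        ofReal_norm, ← mul_pow]
      exact pow_le_pow_left' ((g y).le_opENorm _) 2
    · rw [Set.indicator_of_notMem (by exact hy)]
      simp
  have hmeas : ∀ m : ℤ, Measurable fun y => ENNReal.ofReal (θ ^ (m + 1) - θ ^ m) *
      (if θ ^ (m + 1) * n y ^ 2 ≤ 1 then ENNReal.ofReal (n y ^ 2) else 0) := fun m =>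
    (Measurable.ite (measurableSet_le (by fun_prop) measurable_const)
      (hn.pow_const 2).ennreal_ofReal measurable_const).const_mul _
  refine (ENNReal.tsum_le_tsum h1).trans ?_
  have hmeas' : ∀ m : ℤ, AEMeasurable (fun y => (ENNReal.ofReal (θ ^ (m + 1) - θ ^ m) *
      (if θ ^ (m + 1) * n y ^ 2 ≤ 1 then ENNReal.ofReal (n y ^ 2) else 0)) * ‖u y‖ₑ ^ 2) ν :=
    fun m => ((hmeas m).mul ((Lp.stronglyMeasurable u).enorm.pow_const 2)).aemeasurable
  rw [← lintegral_tsum hmeas', Lp_enorm_sq]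
  refine lintegral_mono fun y => ?_
  rw [ENNReal.tsum_mul_right]
  exact (mul_le_mul_left (tsum_zpow_weight_le hθ _) _).trans (one_mul _).le

lemma lintegral_sum_le [CompleteSpace H] [TopologicalSpace.SeparableSpace G]
    (Φ : Lp H 2 μ ≃ₗᵢ[ℂ] Lp G 2 ν) (hΦ : oneInftyNorm Φ < ∞) {q θ α : ℝ} (hq : 2 < q)
    (hθ : 1 < θ) (hα : 0 < α) {f : X → H →L[ℂ] H} (hf : MemSchattenLp q f μ)
    {g : Y → G →L[ℂ] G} (hg : OpMeasurable g ν) {n : Y → ℝ}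
    (hn : Measurable n) (hgn : ∀ᵐ y ∂ν, ‖g y‖ = n y)
    (hgt : ∀ e : ℝ, 0 < e → ∫⁻ y in {y | 1 < e * n y ^ 2}, ‖g y‖ₑ ^ 2 ∂ν ≠ ∞)
    (hgα : ∀ e : ℝ, 0 < e → oneInftyNorm Φ ^ 2 * ∫⁻ y in {y | 1 < e * n y ^ 2}, ‖g y‖ₑ ^ 2 ∂ν ≤
      ENNReal.ofReal ((α * e ^ ((q - 2) / 4)) ^ 2))
    {N : ℕ} {u gu : Fin N → Lp G 2 ν} (hu : IsBessel u)
    (hgu : ∀ j, gu j =ᵐ[ν] fun y => g y (u j y)) :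
    ∑ j, ∫⁻ x, ‖f x (Φ.symm (gu j) x)‖ₑ ^ 2 ∂μ ≤ schattenLpNorm q f μ ^ (2 : ℝ) *
      (ENNReal.ofReal (ruminConst θ q α) * N) ^ (1 - 2 / q) := by
  have hθ0 : 0 < θ := by linarith
  have hq0 : 0 < q := by linarith
  have hB : ∀ m : ℤ, MeasurableSet {y | 1 < θ ^ (m + 1) * n y ^ 2} := fun m =>
    measurableSet_lt measurable_const (by fun_prop)
  have hBc : ∀ m : ℤ, MeasurableSet {y | θ ^ (m + 1) * n y ^ 2 ≤ 1} := fun m =>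
    measurableSet_le (by fun_prop) measurable_const
  have hlo2 : ∀ (m : ℤ) (j : Fin N), MemLp ({y | θ ^ (m + 1) * n y ^ 2 ≤ 1}.indicator (gu j)) 2 ν :=
    fun m j => (Lp.memLp (gu j)).indicator (hBc m)
  let lo : ℤ → Fin N → Lp G 2 ν := fun m j => (hlo2 m j).toLp
  have hlo : ∀ m j, lo m j =ᵐ[ν]
      {y | θ ^ (m + 1) * n y ^ 2 ≤ 1}.indicator fun y => g y (u j y) := by
    intro m j
    refine (hlo2 m j).coeFn_toLp.trans ?_
    filter_upwards [hgu j] with y hy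
    by_cases h : y ∈ {y | θ ^ (m + 1) * n y ^ 2 ≤ 1}
    · rw [Set.indicator_of_mem h, Set.indicator_of_mem h, hy]
    · rw [Set.indicator_of_notMem h, Set.indicator_of_notMem h]
  have hhi : ∀ m j, (gu j - lo m j : Lp G 2 ν) =ᵐ[ν]
      {y | 1 < θ ^ (m + 1) * n y ^ 2}.indicator fun y => g y (u j y) := by
    intro m j
    filter_upwards [hgu j, hlo m j, Lp.coeFn_sub (gu j) (lo m j)] with y h1 h2 h3
    rw [h3, Pi.sub_apply, h1, h2]
    by_cases h : θ ^ (m + 1) * n y ^ 2 ≤ 1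
    · rw [Set.indicator_of_mem (by exact h), Set.indicator_of_notMem (by simpa using h), sub_self]
    · rw [Set.indicator_of_notMem (by exact h), Set.indicator_of_mem (by simpa using h), sub_zero]
  have hhigh : ∀ᵐ x ∂μ, ∀ (m : ℤ) (c : EuclideanSpace ℂ (Fin N)),
      ‖∑ j, c j • Φ.symm (gu j - lo m j) x‖ ≤ α * (θ ^ (m + 1)) ^ ((q - 2) / 4) * ‖c‖ := by
    rw [ae_all_iff]
    intro m
    have hm : 0 < θ ^ (m + 1) := zpow_pos hθ0 _
    exact ae_norm_sum_symm_le Φ hΦ hg hu (hB m) (hgt _ hm) (hgα _ hm) (by positivity) (hhi m)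
  have hsub : ∀ᵐ x ∂μ, ∀ (m : ℤ) (j : Fin N),
      Φ.symm (gu j - lo m j) x = Φ.symm (gu j) x - Φ.symm (lo m j) x := by
    rw [ae_all_iff]; intro m
    rw [ae_all_iff]; intro j
    rw [map_sub]
    exact Lp.coeFn_sub _ _
  -- The pointwise majorant of the density. Its integral is at most D N: the adjoint of Φ is
  -- isometric, and each `u j` has norm at most 1.
  set K : X → ℝ≥0∞ := fun x => ENNReal.ofReal (ruminConst θ q α) *
    ∑' m : ℤ, ENNReal.ofReal (θ ^ (m + 1) - θ ^ m) * ∑ j, ‖Φ.symm (lo m j) x‖ₑ ^ 2 with hK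
  have hKterm : ∀ (m : ℤ) (j : Fin N), Measurable fun x => ‖Φ.symm (lo m j) x‖ₑ ^ 2 := fun m j =>
    (Lp.stronglyMeasurable _).enorm.pow_const 2
  have hKm' : ∀ m : ℤ, Measurable fun x => ENNReal.ofReal (θ ^ (m + 1) - θ ^ m) *
      ∑ j, ‖Φ.symm (lo m j) x‖ₑ ^ 2 := fun m =>
    (Finset.measurable_fun_sum _ fun j _ => hKterm m j).const_mul _
  have hKm : Measurable K := (Measurable.tsum hKm').const_mul _
  have hKint : ∫⁻ x, K x ∂μ ≤ ENNReal.ofReal (ruminConst θ q α) * N := by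
    rw [hK, lintegral_const_mul _ (Measurable.tsum hKm'),
      lintegral_tsum fun m => (hKm' m).aemeasurable]
    refine mul_le_mul_right ?_ _
    have e1 : ∀ m : ℤ, ∫⁻ x, ENNReal.ofReal (θ ^ (m + 1) - θ ^ m) *
        ∑ j, ‖Φ.symm (lo m j) x‖ₑ ^ 2 ∂μ =
        ∑ j, ENNReal.ofReal (θ ^ (m + 1) - θ ^ m) * ‖lo m j‖ₑ ^ 2 := by
      intro m
      rw [lintegral_const_mul _ (Finset.measurable_fun_sum _ fun j _ => hKterm m j),
        lintegral_finsetSum _ fun j _ => hKterm m j, Finset.mul_sum]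
      refine Finset.sum_congr rfl fun j _ => ?_
      rw [← Lp_enorm_sq, ← ofReal_norm, Φ.symm.norm_map, ofReal_norm]
    simp_rw [e1]
    rw [Summable.tsum_finsetSum fun _ _ => ENNReal.summable]
    calc _ ≤ ∑ j : Fin N, (1 : ℝ≥0∞) := by
          refine Finset.sum_le_sum fun j _ => ?_
          refine (tsum_weight_enorm_sq_le hθ hn hgn (u j) fun m => hlo m j).trans ?_
          refine pow_le_one' ?_ 2
          rw [← ofReal_norm]
          exact ENNReal.ofReal_le_one.2 (hu.norm_le_one j)
      _ = N := by simp
  rw [← lintegral_finsetSum' _ fun j _ =>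
    (hf.1.apply (Lp.aestronglyMeasurable (Φ.symm (gu j)))).enorm.pow_const 2]
  refine (lintegral_le_of_ae_le_mul (G := K) (S := fun x => schattenNorm q (f x)) hq
    (Finset.aemeasurable_fun_sum _ fun j _ =>
      (hf.1.apply (Lp.aestronglyMeasurable (Φ.symm (gu j)))).enorm.pow_const 2) hKm.aemeasurable
    (ne_top_of_le_ne_top (ENNReal.mul_ne_top ENNReal.ofReal_ne_top (ENNReal.natCast_ne_top _))
      hKint) ?_).trans ?_
  · filter_upwards [hf.2.1, hhigh, hsub] with x hx h1 h2
    refine sum_enorm_apply_sq_le hq hθ hα hx (fun j => Φ.symm (gu j) x)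
      (fun m j => Φ.symm (lo m j) x) fun m c => ?_
    simp_rw [← h2]
    exact h1 m c
  · refine mul_le_mul' le_rfl (ENNReal.rpow_le_rpow hKint ?_)
    rw [sub_nonneg, div_le_one hq0]; exact hq.le

end Integrated

/-! ### Truncation to the sets where ‖g‖ is bounded. -/

section Truncation

variable {Y G : Type*} [MeasurableSpace Y] [NormedAddCommGroup G] [InnerProductSpace ℂ G]
  {ν : Measure Y}

/-- The restriction of `u` to the set where `n ≤ k`. -/
def trunc {n : Y → ℝ} (hn : Measurable n) (k : ℕ) (u : Lp G 2 ν) : Lp G 2 ν :=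
  ((Lp.memLp u).indicator (measurableSet_le hn (measurable_const (a := (k : ℝ))))).toLp

omit [InnerProductSpace ℂ G] in
lemma trunc_coeFn {n : Y → ℝ} (hn : Measurable n) (k : ℕ) (u : Lp G 2 ν) :
    trunc hn k u =ᵐ[ν] {y | n y ≤ k}.indicator u :=
  MemLp.coeFn_toLp _

/-- Truncation destroys orthonormality but only shrinks linear combinations pointwise; this is why
the estimates are stated for Bessel families. -/
lemma IsBessel.trunc {n : Y → ℝ} (hn : Measurable n) (k : ℕ) {N : ℕ} {u : Fin N → Lp G 2 ν}
    (hu : IsBessel u) : IsBessel fun j => trunc hn k (u j) := by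
  intro c
  refine (Lp.norm_le_norm_of_ae_le ?_).trans (hu c)
  filter_upwards [Lp_coeFn_sum_smul c fun j => Cwikel.trunc hn k (u j), Lp_coeFn_sum_smul c u,
    ae_all_iff.2 fun j => trunc_coeFn hn k (u j)] with y h1 h2 h3
  rw [h1, h2]
  simp_rw [h3]
  by_cases hy : y ∈ {y | n y ≤ k}
  · simp_rw [Set.indicator_of_mem hy]; rfl
  · simp_rw [Set.indicator_of_notMem hy, smul_zero, Finset.sum_const_zero, norm_zero]
    exact norm_nonneg _

omit [InnerProductSpace ℂ G] in
lemma tendsto_trunc {n : Y → ℝ} (hn : Measurable n) (u : Lp G 2 ν) :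
    Filter.Tendsto (fun k => trunc hn k u) Filter.atTop (nhds u) := by
  have h0 : Filter.Tendsto (fun k => ∫⁻ y, ‖(trunc hn k u - u : Lp G 2 ν) y‖ₑ ^ 2 ∂ν)
      Filter.atTop (nhds (∫⁻ _, 0 ∂ν)) := by
    have hae : ∀ᵐ y ∂ν, ∀ k : ℕ, (trunc hn k u - u : Lp G 2 ν) y =
        {y | n y ≤ k}.indicator u y - u y := by
      rw [ae_all_iff]
      intro k
      filter_upwards [Lp.coeFn_sub (trunc hn k u) u, trunc_coeFn hn k u] with y h1 h2
      rw [h1, Pi.sub_apply, h2]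
    refine tendsto_lintegral_of_dominated_convergence' (fun y => ‖u y‖ₑ ^ 2)
      (fun k => (Lp.aestronglyMeasurable _).enorm.pow_const 2) (fun k => ?_) ?_ ?_
    · filter_upwards [hae] with y hy
      rw [hy k]
      by_cases h : y ∈ {y | n y ≤ k}
      · rw [Set.indicator_of_mem h]; simp
      · rw [Set.indicator_of_notMem h]; simp
    · rw [← Lp_enorm_sq]
      exact ENNReal.pow_ne_top enorm_ne_top
    · filter_upwards [hae] with y hy
      obtain ⟨k₀, hk₀⟩ := exists_nat_ge (n y)
      refine tendsto_const_nhds.congr' ?_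
      filter_upwards [Filter.eventually_ge_atTop k₀] with k hk
      have : y ∈ {y | n y ≤ k} := hk₀.trans (by exact_mod_cast hk)
      rw [hy k, Set.indicator_of_mem this]
      simp
  simp_rw [← Lp_enorm_sq, lintegral_zero] at h0
  rw [tendsto_iff_norm_sub_tendsto_zero]
  have h1 := (ENNReal.continuous_rpow_const (y := (1 / 2 : ℝ))).tendsto 0 |>.comp h0
  rw [ENNReal.zero_rpow_of_pos (by norm_num)] at h1
  have h2 := (ENNReal.tendsto_toReal (a := 0) (by simp)).comp h1
  refine h2.congr fun k => ?_
  simp only [Function.comp_apply]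
  rw [← ENNReal.rpow_natCast, ← ENNReal.rpow_mul]
  norm_num

lemma memLp_apply_trunc {g : Y → G →L[ℂ] G} (hg : OpMeasurable g ν) {n : Y → ℝ}
    (hn : Measurable n) (hgn : ∀ᵐ y ∂ν, ‖g y‖ = n y) (k : ℕ) (u : Lp G 2 ν) :
    MemLp (fun y => g y (trunc hn k u y)) 2 ν := by
  refine MemLp.of_le_mul (g := u) (c := k) (Lp.memLp u)
    (hg.apply (Lp.aestronglyMeasurable _)) ?_
  filter_upwards [trunc_coeFn hn k u, hgn] with y h1 h2
  rw [h1]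
  by_cases hy : n y ≤ k
  · rw [Set.indicator_of_mem (by exact hy)]
    exact ((g y).le_opNorm _).trans (by rw [h2]; gcongr)
  · rw [Set.indicator_of_notMem (by exact hy), map_zero, norm_zero]
    positivity

end Truncation

/-! ### The natural domain and the bounded extension. -/

section Extension

variable {X Y H G : Type*} [MeasurableSpace X] [MeasurableSpace Y]
  [NormedAddCommGroup H] [InnerProductSpace ℂ H] [CompleteSpace H]
  [NormedAddCommGroup G] [InnerProductSpace ℂ G] [CompleteSpace G]
  {μ : Measure X} {ν : Measure Y} {f : X → H →L[ℂ] H} {Φ : Lp H 2 μ ≃ₗᵢ[ℂ] Lp G 2 ν}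
  {g : Y → G →L[ℂ] G}

lemma adjoint_coe_apply (Φ : Lp H 2 μ ≃ₗᵢ[ℂ] Lp G 2 ν) (v : Lp G 2 ν) :
    ContinuousLinearMap.adjoint (Φ.toContinuousLinearEquiv : Lp H 2 μ →L[ℂ] Lp G 2 ν) v =
      Φ.symm v := by
  refine ext_inner_right ℂ fun w => ?_
  rw [ContinuousLinearMap.adjoint_inner_left, ← Φ.inner_map_map (Φ.symm v) w, Φ.apply_symm_apply]
  rfl

lemma mem_cwikelOp_domain {u : Lp G 2 ν} (h1 : MemLp (fun y => g y (u y)) 2 ν)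
    (h2 : MemLp (fun x => f x (Φ.symm h1.toLp x)) 2 μ) : u ∈ (cwikelOp f Φ g).domain := by
  refine ⟨h1, ?_⟩
  change MemLp (fun x => f x (ContinuousLinearMap.adjoint
    (Φ.toContinuousLinearEquiv : Lp H 2 μ →L[ℂ] Lp G 2 ν) h1.toLp x)) 2 μ
  rw [adjoint_coe_apply]
  exact h2

lemma memLp_of_mem_cwikelOp_domain {u : Lp G 2 ν} (hu : u ∈ (cwikelOp f Φ g).domain) :
    MemLp (fun y => g y (u y)) 2 ν := hu.1

lemma cwikelOp_apply_enorm_sq {u : Lp G 2 ν} (hu : u ∈ (cwikelOp f Φ g).domain)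
    (h1 : MemLp (fun y => g y (u y)) 2 ν) :
    ‖cwikelOp f Φ g ⟨u, hu⟩‖ₑ ^ 2 = ∫⁻ x, ‖f x (Φ.symm h1.toLp x)‖ₑ ^ 2 ∂μ := by
  obtain ⟨h, h'⟩ := hu
  have e : cwikelOp f Φ g ⟨u, ⟨h, h'⟩⟩ = MemLp.toLp (fun x => f x (ContinuousLinearMap.adjoint
    (Φ.toContinuousLinearEquiv : Lp H 2 μ →L[ℂ] Lp G 2 ν) h1.toLp x)) h' := rfl
  rw [e, Lp_enorm_sq, ← adjoint_coe_apply]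
  refine lintegral_congr_ae ?_
  filter_upwards [MemLp.coeFn_toLp h'] with x hx
  exact congrArg (fun z => ‖z‖ₑ ^ 2) hx

/-- If `f Φ* g` obeys an estimate on Bessel families, it extends to a bounded operator that obeys
the estimate on orthonormal families. -/
lemma exists_extension (hf : OpMeasurable f μ) (hg : OpMeasurable g ν) {n : Y → ℝ}
    (hn : Measurable n) (hgn : ∀ᵐ y ∂ν, ‖g y‖ = n y)
    {S : Set (ℕ → ℝ≥0∞)} {b₀ : ℕ → ℝ≥0∞} (hb₀ : b₀ ∈ S) (hb₀t : b₀ 1 ≠ ∞)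
    (hS : ∀ b ∈ S, ∀ (N : ℕ) (u gu : Fin N → Lp G 2 ν), IsBessel u →
      (∀ j, gu j =ᵐ[ν] fun y => g y (u j y)) →
      ∑ j, ∫⁻ x, ‖f x (Φ.symm (gu j) x)‖ₑ ^ 2 ∂μ ≤ b N) :
    Dense ((cwikelOp f Φ g).domain : Set (Lp G 2 ν)) ∧
    ∃ K : Lp G 2 ν →L[ℂ] Lp H 2 μ, (∀ u : (cwikelOp f Φ g).domain, K u = cwikelOp f Φ g u) ∧
      ∀ b ∈ S, ∀ (N : ℕ) (u : Fin N → Lp G 2 ν), Orthonormal ℂ u →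
        ∑ j, ‖K (u j)‖ₑ ^ 2 ≤ b N := by
  -- The case N = 1, applied to u/‖u‖. It makes f Φ*(g u) square integrable as soon as g u is, so
  -- the natural domain contains all truncations and is dense.
  have hbound : ∀ (u : Lp G 2 ν) (h1 : MemLp (fun y => g y (u y)) 2 ν),
      ∫⁻ x, ‖f x (Φ.symm h1.toLp x)‖ₑ ^ 2 ∂μ ≤ b₀ 1 * ‖u‖ₑ ^ 2 := by
    intro u h1
    rcases eq_or_ne u 0 with hu | hu
    · have e : h1.toLp = 0 := by
        refine Lp.ext (h1.coeFn_toLp.trans ?_)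
        filter_upwards [Lp.coeFn_zero G 2 ν] with y hy
        rw [hy, hu, hy, Pi.zero_apply, map_zero]
      rw [e, map_zero]
      refine le_trans (le_of_eq ?_) zero_le
      rw [← lintegral_zero (μ := μ)]
      refine lintegral_congr_ae ?_
      filter_upwards [Lp.coeFn_zero H 2 μ] with x hx
      rw [hx]; simp
    · have hun : 0 < ‖u‖ := norm_pos_iff.2 hu
      set c : ℂ := ((‖u‖⁻¹ : ℝ) : ℂ) with hc
      have hcn : ‖c‖ = ‖u‖⁻¹ := by
        rw [hc, Complex.norm_real, Real.norm_of_nonneg (by positivity)]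
      have h2 := hS b₀ hb₀ 1 (fun _ => c • u) (fun _ => c • h1.toLp) (by
        intro d
        rw [Fin.sum_univ_one, norm_smul, norm_smul, hcn, inv_mul_cancel₀ hun.ne', mul_one]
        exact PiLp.norm_apply_le d 0) (by
        intro _
        filter_upwards [Lp.coeFn_smul c h1.toLp, Lp.coeFn_smul c u, h1.coeFn_toLp] with y e1 e2 e3
        rw [e1, e2, Pi.smul_apply, Pi.smul_apply, map_smul, e3])
      rw [Fin.sum_univ_one] at h2
      have e : ∫⁻ x, ‖f x (Φ.symm (c • h1.toLp) x)‖ₑ ^ 2 ∂μ =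
          ‖c‖ₑ ^ 2 * ∫⁻ x, ‖f x (Φ.symm h1.toLp x)‖ₑ ^ 2 ∂μ := by
        rw [← lintegral_const_mul'' _
          ((hf.apply (Lp.aestronglyMeasurable _)).enorm.pow_const 2), map_smul]
        refine lintegral_congr_ae ?_
        filter_upwards [Lp.coeFn_smul c (Φ.symm h1.toLp)] with x hx
        rw [hx, Pi.smul_apply, map_smul, enorm_smul, mul_pow]
      rw [e] at h2
      have h3 : ‖c‖ₑ * ‖u‖ₑ = 1 := by
        rw [← ofReal_norm, ← ofReal_norm, ← ENNReal.ofReal_mul (norm_nonneg _), hcn,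
          inv_mul_cancel₀ hun.ne', ENNReal.ofReal_one]
      have h4 := mul_le_mul_left h2 (‖u‖ₑ ^ 2)
      rwa [mul_right_comm, ← mul_pow, h3, one_pow, one_mul] at h4
  have hdom : ∀ u : Lp G 2 ν, MemLp (fun y => g y (u y)) 2 ν → u ∈ (cwikelOp f Φ g).domain := by
    intro u h1
    refine mem_cwikelOp_domain h1 ⟨hf.apply (Lp.aestronglyMeasurable _), ?_⟩
    have h2 := (hbound u h1).trans_lt (ENNReal.mul_lt_top hb₀t.lt_top
      (ENNReal.pow_lt_top enorm_lt_top))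
    rw [← eLpNorm_two_sq] at h2
    exact (ENNReal.pow_lt_top_iff.1 h2).resolve_right two_ne_zero
  have htr : ∀ k u, trunc hn k u ∈ (cwikelOp f Φ g).domain := fun k u =>
    hdom _ (memLp_apply_trunc hg hn hgn k u)
  have hdense : Dense ((cwikelOp f Φ g).domain : Set (Lp G 2 ν)) := fun u =>
    mem_closure_of_tendsto (tendsto_trunc hn u) (Filter.Eventually.of_forall fun k => htr k u)
  refine ⟨hdense, ?_⟩
  set c₀ : ℝ := ((b₀ 1) ^ (1 / 2 : ℝ)).toReal with hc₀
  have hnorm : ∀ u : (cwikelOp f Φ g).domain, ‖cwikelOp f Φ g u‖ ≤ c₀ * ‖u‖ := by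
    rintro ⟨u, hu⟩
    have h1 := memLp_of_mem_cwikelOp_domain hu
    have h2 := (cwikelOp_apply_enorm_sq hu h1).trans_le (hbound u h1)
    have h3 := ENNReal.rpow_le_rpow h2 (z := 1 / 2) (by norm_num)
    rw [ENNReal.mul_rpow_of_nonneg _ _ (by norm_num), ← ENNReal.rpow_natCast,
      ← ENNReal.rpow_natCast, ← ENNReal.rpow_mul, ← ENNReal.rpow_mul] at h3
    norm_num at h3
    have h4 := ENNReal.toReal_mono (ENNReal.mul_ne_top
      (ENNReal.rpow_ne_top_of_nonneg (by norm_num) hb₀t) enorm_ne_top) h3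
    rw [ENNReal.toReal_mul, toReal_enorm, toReal_enorm] at h4
    rw [hc₀]
    norm_num
    exact h4
  let K₀ : (cwikelOp f Φ g).domain →L[ℂ] Lp H 2 μ :=
    (cwikelOp f Φ g).toFun.mkContinuous c₀ hnorm
  have hdr : DenseRange (cwikelOp f Φ g).domain.subtypeL := by
    rw [DenseRange]
    simpa using hdense
  have hui : IsUniformInducing (cwikelOp f Φ g).domain.subtypeL := isUniformInducing_val _
  let K := K₀.extend (cwikelOp f Φ g).domain.subtypeL
  have hK : ∀ u : (cwikelOp f Φ g).domain, K u = cwikelOp f Φ g u := fun u =>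
    K₀.extend_eq hdr hui u
  refine ⟨K, hK, fun b hb N u hu => ?_⟩
  -- Vectors of an orthonormal family need not lie in the domain; their truncations do and form a
  -- Bessel family, and continuity of `K` gives the limit.
  have hlim : Filter.Tendsto (fun k => ∑ j, ‖K (trunc hn k (u j))‖ₑ ^ 2) Filter.atTop
      (nhds (∑ j, ‖K (u j)‖ₑ ^ 2)) := by
    refine tendsto_finsetSum _ fun j _ => ?_
    exact ((ENNReal.continuous_pow 2).tendsto _).comp
      (((K.continuous.tendsto _).comp (tendsto_trunc hn (u j))).enorm)
  refine le_of_tendsto hlim (Filter.Eventually.of_forall fun k => ?_)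
  have hB : IsBessel fun j => trunc hn k (u j) :=
    IsBessel.trunc hn k fun c => (norm_sum_smul_of_orthonormal hu c).le
  refine le_trans (le_of_eq ?_) (hS b hb N _ (fun j => (memLp_apply_trunc hg hn hgn k (u j)).toLp)
    hB fun j => MemLp.coeFn_toLp _)
  refine Finset.sum_congr rfl fun j _ => ?_
  rw [← cwikelOp_apply_enorm_sq (htr k (u j)), ← hK ⟨_, htr k (u j)⟩]

end Extension

/-! ### The numerical constant. -/

section Constants

/-- The ratio of the geometric grid. -/
def gridRatio (q : ℝ) : ℝ := Real.exp (2 / q) / (1 + 2 / q)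

lemma one_lt_gridRatio {q : ℝ} (hq : 0 < q) : 1 < gridRatio q := by
  have h : 0 < 2 / q := by positivity
  rw [gridRatio, one_lt_div (by positivity), add_comm]
  exact Real.add_one_lt_exp h.ne'

lemma ruminConst_nonneg {q α : ℝ} (hq : 2 < q) (hα : 0 < α) :
    0 ≤ ruminConst (gridRatio q) q α := by
  have := one_lt_gridRatio (show 0 < q by linarith)
  have : 0 < q - 2 := by linarith
  rw [ruminConst]
  positivity

/-- Without θ the constant is α^(4/(q-2)) (q/(q-2))² (1 + 2/q). The grid ratio replaces 1 + 2/q by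
exp(2/q), and exp(2/q)^(q/2-1) = exp(1 - 2/q) ≤ q/2 because log t ≥ 1 - 1/t at t = q/2. -/
lemma ruminConst_rpow_le {q α : ℝ} (hq : 2 < q) (hα : 0 < α) :
    ruminConst (gridRatio q) q α ^ (q / 2 - 1) ≤ α ^ 2 * (q / 2 * (q / (q - 2)) ^ (q - 2)) := by
  have hq0 : 0 < q := by linarith
  have hq2 : 0 < q - 2 := by linarith
  have e1 : ruminConst (gridRatio q) q α =
      α ^ (4 / (q - 2)) * Real.exp (2 / q) * (q / (q - 2)) ^ 2 := by
    rw [ruminConst, gridRatio, one_div_div]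
    field_simp
    ring
  have e2 : (α ^ (4 / (q - 2))) ^ (q / 2 - 1) = α ^ 2 := by
    rw [← Real.rpow_mul hα.le, show 4 / (q - 2) * (q / 2 - 1) = (2 : ℕ) by field_simp; norm_num,
      Real.rpow_natCast]
  have e3 : ((q / (q - 2)) ^ 2) ^ (q / 2 - 1) = (q / (q - 2)) ^ (q - 2) := by
    rw [← Real.rpow_natCast, ← Real.rpow_mul (by positivity)]
    congr 1
    push_cast
    ring
  have e4 : Real.exp (2 / q) ^ (q / 2 - 1) ≤ q / 2 := by
    rw [← Real.exp_mul, ← Real.le_log_iff_exp_le (by positivity)]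
    have h := Real.one_sub_inv_le_log_of_pos (show 0 < q / 2 by positivity)
    refine le_trans (le_of_eq ?_) h
    field_simp
  rw [e1, Real.mul_rpow (by positivity) (by positivity), Real.mul_rpow (by positivity)
    (by positivity), e2, e3, mul_assoc]
  gcongr

/-- Solving the estimate on orthonormal families for their size. -/
lemma ofReal_rpow_mul_natCast_le {q κ D : ℝ} (hq : 2 < q) (hκ : 0 < κ) (hD : 0 ≤ D) {F : ℝ≥0∞}
    {N : ℕ} (h : N * ENNReal.ofReal κ ^ 2 ≤ F ^ (2 : ℝ) * (ENNReal.ofReal D * N) ^ (1 - 2 / q)) :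
    ENNReal.ofReal (κ ^ q) * N ≤ F ^ q * ENNReal.ofReal (D ^ (q / 2 - 1)) := by
  have hq0 : 0 < q := by linarith
  rcases Nat.eq_zero_or_pos N with rfl | hN
  · simp
  have hN0 : (N : ℝ≥0∞) ≠ 0 := by exact_mod_cast hN.ne'
  have hNt : (N : ℝ≥0∞) ≠ ∞ := ENNReal.natCast_ne_top N
  have h1 := ENNReal.rpow_le_rpow h (z := q / 2) (by positivity)
  have e0 : (1 - 2 / q) * (q / 2) = q / 2 - 1 := by field_simp
  rw [ENNReal.mul_rpow_of_nonneg _ _ (by positivity), ENNReal.mul_rpow_of_nonneg _ _ (by positivity),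
    ← ENNReal.rpow_natCast, ← ENNReal.rpow_mul, ← ENNReal.rpow_mul, ← ENNReal.rpow_mul, e0,
    ENNReal.mul_rpow_of_nonneg _ _ (by linarith),
    show ((2 : ℕ) : ℝ) * (q / 2) = q by push_cast; field_simp,
    show (2 : ℝ) * (q / 2) = q by field_simp,
    ENNReal.ofReal_rpow_of_nonneg hκ.le hq0.le, ENNReal.ofReal_rpow_of_nonneg hD (by linarith)] at h1
  have e3 : (N : ℝ≥0∞) ^ (q / 2) = N ^ (q / 2 - 1) * N := by
    conv_rhs => rw [← ENNReal.rpow_one (N : ℝ≥0∞), ← ENNReal.rpow_mul, one_mul]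
    rw [← ENNReal.rpow_add _ _ hN0 hNt]
    congr 1
    ring
  have hc0 : (N : ℝ≥0∞) ^ (q / 2 - 1) ≠ 0 := by simp [hN0, hNt]
  have hct : (N : ℝ≥0∞) ^ (q / 2 - 1) ≠ ∞ := ENNReal.rpow_ne_top_of_nonneg (by linarith) hNt
  rw [e3] at h1
  refine (ENNReal.mul_le_mul_iff_right hc0 hct).1 (le_trans (le_of_eq ?_) (h1.trans (le_of_eq ?_)))
  · ring
  · ring

end Constants

/-! ### The weak norm of g and the conclusion. -/

section Final

variable {Y G : Type*} [MeasurableSpace Y] [NormedAddCommGroup G] [InnerProductSpace ℂ G]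
  {ν : Measure Y}

lemma weakLpNorm_rpow {q : ℝ} (hq : 0 < q) (g : Y → G →L[ℂ] G) :
    weakLpNorm q g ν ^ q =
      ⨆ τ : Set.Ioi (0 : ℝ), ENNReal.ofReal ((τ : ℝ) ^ q) * ν {y | (τ : ℝ) < ‖g y‖} := by
  rw [weakLpNorm, ← ENNReal.rpow_mul, one_div_mul_cancel hq.ne', ENNReal.rpow_one]

lemma weakSchattenNorm_rpow {E F : Type*} [NormedAddCommGroup E] [InnerProductSpace ℂ E]
    [CompleteSpace E] [NormedAddCommGroup F] [InnerProductSpace ℂ F] [CompleteSpace F] {q : ℝ}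
    (hq : 0 < q) (K : E →L[ℂ] F) :
    weakSchattenNorm q K ^ q =
      ⨆ κ : Set.Ioi (0 : ℝ), ENNReal.ofReal ((κ : ℝ) ^ q) * eigenCount κ (absOp K) := by
  rw [weakSchattenNorm, ← ENNReal.rpow_mul, one_div_mul_cancel hq.ne', ENNReal.rpow_one]

lemma setLIntegral_enorm_sq_le_weakLpNorm {q : ℝ} (hq : 2 < q) {g : Y → G →L[ℂ] G} {n : Y → ℝ}
    (hn : Measurable n) (hn0 : ∀ y, 0 ≤ n y) (hgn : ∀ᵐ y ∂ν, ‖g y‖ = n y) {e : ℝ} (he : 0 < e) :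
    ∫⁻ y in {y | 1 < e * n y ^ 2}, ‖g y‖ₑ ^ 2 ∂ν ≤
      weakLpNorm q g ν ^ q * ENNReal.ofReal (q / (q - 2) * e ^ ((q - 2) / 2)) := by
  have hq0 : 0 < q := by linarith
  -- The condition e n² > 1 means n > e^(-1/2).
  set E := e ^ (-(1 / 2) : ℝ) with hE
  have hE0 : 0 < E := by positivity
  have hE2 : e * E ^ 2 = 1 := by
    rw [hE, ← Real.rpow_natCast, ← Real.rpow_mul he.le]
    norm_num
    rw [Real.rpow_neg_one, mul_inv_cancel₀ he.ne']
  have hset : {y | 1 < e * n y ^ 2} = {y | E < n y} := by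
    ext y
    simp only [Set.mem_ofPred_eq]
    rw [← hE2, mul_lt_mul_iff_right₀ he, pow_lt_pow_iff_left₀ hE0.le (hn0 y) two_ne_zero]
  have hW : ∀ τ : ℝ, 0 < τ →
      ENNReal.ofReal (τ ^ q) * ν {y | τ < n y} ≤ weakLpNorm q g ν ^ q := by
    intro τ hτ
    have : ν {y | τ < n y} = ν {y | τ < ‖g y‖} := by
      refine measure_congr ?_
      filter_upwards [hgn] with y hy
      exact propext (by change τ < n y ↔ τ < ‖g y‖; rw [hy])
    rw [this, weakLpNorm_rpow hq0]
    exact le_iSup (fun τ : Set.Ioi (0 : ℝ) =>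
      ENNReal.ofReal ((τ : ℝ) ^ q) * ν {y | (τ : ℝ) < ‖g y‖}) ⟨τ, hτ⟩
  have h1 := setLIntegral_sq_le_of_weak ν hn hn0 hq hW hE0
  rw [hset]
  refine le_trans (le_of_eq ?_) (h1.trans (le_of_eq ?_))
  · refine lintegral_congr_ae (ae_restrict_of_ae ?_)
    filter_upwards [hgn] with y hy
    rw [← hy, ENNReal.ofReal_pow (norm_nonneg _), ofReal_norm]
  · congr 3
    rw [hE, ← Real.rpow_mul he.le]
    congr 1
    ring

end Final

end Cwikel

end

open Cwikel in
theorem mainTheorem4 {X Y H G : Type*} [MeasurableSpace X] [MeasurableSpace Y]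
    [NormedAddCommGroup H] [InnerProductSpace ℂ H] [CompleteSpace H]
    [TopologicalSpace.SeparableSpace H]
    [NormedAddCommGroup G] [InnerProductSpace ℂ G] [CompleteSpace G]
    [TopologicalSpace.SeparableSpace G]
    (μ : Measure X) [SigmaFinite μ] (ν : Measure Y) [SigmaFinite ν]
    (Φ : Lp H 2 μ ≃ₗᵢ[ℂ] Lp G 2 ν) (hΦ : Cwikel.oneInftyNorm Φ < ∞)
    (q : ℝ) (hq : 2 < q)
    (f : X → H →L[ℂ] H) (hf : Cwikel.MemSchattenLp q f μ)
    (g : Y → G →L[ℂ] G) (hg : Cwikel.MemWeakLp q g ν) :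
    Dense ((Cwikel.cwikelOp f Φ g).domain : Set (Lp G 2 ν)) ∧
    ∃ K : Lp G 2 ν →L[ℂ] Lp H 2 μ,
      (∀ u : (Cwikel.cwikelOp f Φ g).domain, K u = Cwikel.cwikelOp f Φ g u) ∧
      Cwikel.MemWeakSchatten q K ∧
      Cwikel.weakSchattenNorm q K ^ q ≤
        ENNReal.ofReal (q / 2 * (q / (q - 2)) ^ (q - 1)) * Cwikel.oneInftyNorm Φ ^ 2 *
          Cwikel.schattenLpNorm q f μ ^ q * Cwikel.weakLpNorm q g ν ^ q := by
  have hq0 : 0 < q := by linarith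
  have hq2 : 0 < q - 2 := by linarith
  obtain ⟨n, hn, hn0, hgn⟩ := hg.1.exists_measurable_norm
  set W := weakLpNorm q g ν ^ q with hW
  have hWt : W ≠ ∞ := ENNReal.rpow_ne_top_of_nonneg hq0.le hg.2.ne
  set F := schattenLpNorm q f μ with hF
  have hFt : F ≠ ∞ := hf.2.2.ne
  set C := oneInftyNorm Φ with hC
  set A := C ^ 2 * W * ENNReal.ofReal (q / (q - 2)) with hA
  have hAt : A ≠ ∞ := ENNReal.mul_ne_top
    (ENNReal.mul_ne_top (ENNReal.pow_ne_top hΦ.ne) hWt) ENNReal.ofReal_ne_top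
  have hθ := one_lt_gridRatio hq0
  -- All admissible α are handled at once, so that a single extension `K` satisfies every bound.
  -- Since `A` may be 0 while α must be positive, α² = A + ε is used and ε tends to 0 at the end.
  let S : Set (ℕ → ℝ≥0∞) := {b | ∃ α : ℝ, 0 < α ∧ A ≤ ENNReal.ofReal (α ^ 2) ∧
    b = fun N : ℕ => F ^ (2 : ℝ) * (ENNReal.ofReal (ruminConst (gridRatio q) q α) * N) ^ (1 - 2 / q)}
  have hr : 0 ≤ 1 - 2 / q := by rw [sub_nonneg, div_le_one hq0]; exact hq.le
  have hadm : ∀ ε : ℝ, 0 < ε → 0 < √(A.toReal + ε) ∧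
      A ≤ ENNReal.ofReal (√(A.toReal + ε) ^ 2) := by
    intro ε hε
    have h0 := ENNReal.toReal_nonneg (a := A)
    refine ⟨Real.sqrt_pos.2 (by positivity), ?_⟩
    rw [Real.sq_sqrt (by positivity), ← ENNReal.ofReal_toReal hAt]
    refine ENNReal.ofReal_le_ofReal ?_
    rw [ENNReal.ofReal_toReal hAt]
    linarith
  have hb₀ : (fun N : ℕ => F ^ (2 : ℝ) * (ENNReal.ofReal (ruminConst (gridRatio q) q
      √(A.toReal + 1)) * N) ^ (1 - 2 / q)) ∈ S :=
    ⟨_, (hadm 1 one_pos).1, (hadm 1 one_pos).2, rfl⟩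
  obtain ⟨hdense, K, hK, hKb⟩ := exists_extension (f := f) (Φ := Φ) (g := g) hf.1 hg.1 hn hgn
    (S := S) hb₀ (by
      refine ENNReal.mul_ne_top (ENNReal.rpow_ne_top_of_nonneg two_pos.le hFt)
        (ENNReal.rpow_ne_top_of_nonneg hr (ENNReal.mul_ne_top ENNReal.ofReal_ne_top ?_))
      exact ENNReal.natCast_ne_top 1) (by
      rintro b ⟨α, hα, hAα, rfl⟩ N u gu hu hgu
      refine lintegral_sum_le Φ hΦ hq hθ hα hf hg.1 hn hgn (fun e he => ?_) (fun e he => ?_) hu hgu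
      · exact ne_top_of_le_ne_top (ENNReal.mul_ne_top hWt ENNReal.ofReal_ne_top)
          (setLIntegral_enorm_sq_le_weakLpNorm hq hn hn0 hgn he)
      · refine (mul_le_mul_right (setLIntegral_enorm_sq_le_weakLpNorm hq hn hn0 hgn he) _).trans ?_
        rw [ENNReal.ofReal_mul (by positivity), ← mul_assoc, ← mul_assoc]
        refine (mul_le_mul_left hAα _).trans (le_of_eq ?_)
        rw [← ENNReal.ofReal_mul (by positivity), mul_pow, ← Real.rpow_natCast (e ^ _),
          ← Real.rpow_mul he.le]
        congr 3
        push_cast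
        ring)
  refine ⟨hdense, K, hK, ?_⟩
  have hN : ∀ κ : ℝ, 0 < κ → ∀ (N : ℕ) (u : Fin N → Lp G 2 ν), Orthonormal ℂ u →
      (∀ j, κ ≤ ‖K (u j)‖) → ∀ ε : ℝ, 0 < ε → ENNReal.ofReal (κ ^ q) * N ≤
        F ^ q * ENNReal.ofReal ((A.toReal + ε) * (q / 2 * (q / (q - 2)) ^ (q - 2))) := by
    intro κ hκ N u hu hKu ε hε
    obtain ⟨h1, h2⟩ := hadm ε hε
    refine (ofReal_rpow_mul_natCast_le hq hκ (ruminConst_nonneg hq h1) (F := F) ?_).trans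
      (mul_le_mul_right (ENNReal.ofReal_le_ofReal ((ruminConst_rpow_le hq h1).trans ?_)) _)
    · refine le_trans ?_ (hKb _ ⟨_, h1, h2, rfl⟩ N u hu)
      calc (N : ℝ≥0∞) * ENNReal.ofReal κ ^ 2 = ∑ _j : Fin N, ENNReal.ofReal κ ^ 2 := by simp
        _ ≤ _ := Finset.sum_le_sum fun j _ => by
          rw [← ofReal_norm]
          exact pow_le_pow_left' (ENNReal.ofReal_le_ofReal (hKu j)) 2
    · rw [Real.sq_sqrt (add_nonneg ENNReal.toReal_nonneg hε.le)]
  have hNlim : ∀ κ : ℝ, 0 < κ → ∀ (N : ℕ) (u : Fin N → Lp G 2 ν), Orthonormal ℂ u →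
      (∀ j, κ ≤ ‖K (u j)‖) → ENNReal.ofReal (κ ^ q) * N ≤
        ENNReal.ofReal (q / 2 * (q / (q - 2)) ^ (q - 1)) * C ^ 2 * F ^ q * W := by
    intro κ hκ N u hu hKu
    have hlim : Filter.Tendsto (fun ε : ℝ => F ^ q *
        ENNReal.ofReal ((A.toReal + ε) * (q / 2 * (q / (q - 2)) ^ (q - 2))))
        (nhdsWithin 0 (Set.Ioi 0))
        (nhds (F ^ q * ENNReal.ofReal ((A.toReal + 0) * (q / 2 * (q / (q - 2)) ^ (q - 2))))) := by
      refine Filter.Tendsto.mono_left (Continuous.tendsto ?_ 0) nhdsWithin_le_nhds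
      refine (ENNReal.continuous_const_mul (ENNReal.rpow_ne_top_of_nonneg hq0.le hFt)).comp ?_
      exact ENNReal.continuous_ofReal.comp (by fun_prop)
    refine (ge_of_tendsto hlim ?_).trans (le_of_eq ?_)
    · filter_upwards [self_mem_nhdsWithin] with ε hε using hN κ hκ N u hu hKu ε hε
    · rw [add_zero, ENNReal.ofReal_mul ENNReal.toReal_nonneg, ENNReal.ofReal_toReal hAt, hA]
      have : q / 2 * (q / (q - 2)) ^ (q - 1) =
          q / (q - 2) * (q / 2 * (q / (q - 2)) ^ (q - 2)) := by
        rw [show q - 1 = 1 + (q - 2) by ring, Real.rpow_add (by positivity), Real.rpow_one]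
        ring
      rw [this, ENNReal.ofReal_mul (show 0 ≤ q / (q - 2) by positivity)]
      ring
  set M := ENNReal.ofReal (q / 2 * (q / (q - 2)) ^ (q - 1)) * C ^ 2 * F ^ q * W with hM
  have hMt : M ≠ ∞ := ENNReal.mul_ne_top (ENNReal.mul_ne_top (ENNReal.mul_ne_top
    ENNReal.ofReal_ne_top (ENNReal.pow_ne_top hΦ.ne)) (ENNReal.rpow_ne_top_of_nonneg hq0.le hFt)) hWt
  have hNdiv : ∀ κ : ℝ, 0 < κ → ∀ (N : ℕ) (u : Fin N → Lp G 2 ν), Orthonormal ℂ u →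
      (∀ j, κ ≤ ‖K (u j)‖) → (N : ℝ≥0∞) ≤ M / ENNReal.ofReal (κ ^ q) := by
    intro κ hκ N u hu hKu
    rw [ENNReal.le_div_iff_mul_le (Or.inl (by simpa using Real.rpow_pos_of_pos hκ q))
      (Or.inl ENNReal.ofReal_ne_top), mul_comm]
    exact hNlim κ hκ N u hu hKu
  have hcompact : IsCompactOperator K := by
    refine isCompactOperator_of_orthonormal_bound K fun ε hε => ?_
    have ht : M / ENNReal.ofReal (ε ^ q) ≠ ∞ :=
      ENNReal.div_ne_top hMt (by simpa using Real.rpow_pos_of_pos hε q)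
    obtain ⟨m, hm⟩ := ENNReal.exists_nat_gt ht
    refine ⟨m, fun N u hu hKu => ?_⟩
    have := (hNdiv ε hε N u hu hKu).trans hm.le
    exact_mod_cast this
  have hle : weakSchattenNorm q K ^ q ≤ M := by
    rw [weakSchattenNorm_rpow hq0]
    refine iSup_le fun κ => ?_
    refine (mul_le_mul_right (eigenCount_absOp_le K (hNdiv κ κ.2)) _).trans ?_
    exact ENNReal.mul_div_le
  exact ⟨⟨hcompact, (ENNReal.rpow_lt_top_iff_of_pos hq0).1 (hle.trans_lt hMt.lt_top)⟩, hle⟩
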